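/- Let $H$ be an infinite-dimensional complex Hilbert space, $1\le p<\infty$, and let $\omega=(\omega_n)_{n\ge1}$ be a non-increasing sequence of positive numbers with $\omega_n\to0$ and $W_k=\sum_{n=1}^k\omega_n\to\infty$. For a real null sequence $\xi$ let $\xi^*$ be the decreasing rearrangement of $|\xi|$, and put $$\|\xi\|_{l_p}=\Bigl(\sum_n|\xi_n|^p\Bigr)^{1/p},\qquad \|\xi\|_{l^p_\omega}=\Bigl(\sum_n(\xi_n^*)^p\omega_n\Bigr)^{1/p},\qquad \|\xi\|_{m^p_W}=\sup_{k\ge1}\Bigl(\frac{\sum_{n=1}^k(\xi_n^*)^p}{W_k}\Bigr)^{1/p};$$ $l_p$, $l^p_\omega$ and $m^p_W$ are the spaces of null sequences for which the respective quantity is finite. For $E$ one of these spaces let $C_E$ be the set of compact operators $x$ on $H$ whose sequence of singular values $(s_n(x))$ (the eigenvalues of $|x|=(x^*x)^{1/2}$ in decreasing order, counted with multiplicity) lies in $E$, with $\|x\|_{C_E}=\|(s_n(x))\|_E$, and write $C_p=C_{l_p}$. Let $C_p:C_{l^p_\omega}$ be the set of bounded operators $a$ on $H$ with $ax\in C_p$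 for all $x\in C_{l^p_\omega}$, and put $\|a\|_{C_p:C_{l^p_\omega}}=\sup\{\|ax\|_{C_p}:x\in C_{l^p_\omega},\ \|x\|_{C_{l^p_\omega}}\le1\}$. A linear map $\delta\colon C_{l^p_\omega}\to C_p$ is a derivation if $\delta(xy)=\delta(x)y+x\delta(y)$ for all $x,y$; its norm is $\|\delta\|=\sup\{\|\delta(x)\|_{C_p}:\|x\|_{C_{l^p_\omega}}\le1\}$. Then a linear map $\delta\colon C_{l^p_\omega}\to C_p$ is a derivation if and only if there is $a\in C_{m^p_W}$ with $\delta(x)=\delta_a(x):=ax-xa$ for all $x\in C_{l^p_\omega}$. Moreover, every $a\in C_{m^p_W}$ belongs to $C_p:C_{l^p_\omega}$, $\delta_a$ maps $C_{l^p_\omega}$ into $C_p$, and $$\|\delta_a\|\le2\|a\|_{C_p:C_{l^p_\omega}}\le4\|a\|_{C_{m^p_W}}<\infty .$$ -/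

import Mathlib

open scoped ENNReal Topology
open Filter

namespace SymmIdeal

section
variable {H : Type*} [NormedAddCommGroup H] [InnerProductSpace ℂ H] [CompleteSpace H]

/-- The span of all eigenvectors of `|x| = (x⋆ x)^(1/2)` with eigenvalue larger than `s`. For compact
`x` and `s > 0` its dimension is the number of eigenvalues of `|x|` larger than `s`, counted with
multiplicity. -/
noncomputable def topSpace (x : H →L[ℂ] H) (s : ℝ) : Submodule ℂ H :=
  ⨆ μ : Set.Ioi s,
    Module.End.eigenspace ((CFC.abs x : H →L[ℂ] H) : H →ₗ[ℂ] H) ((μ : ℝ) : ℂ)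

/-- The singular values: `singularValue x n` is the `(n+1)`-st eigenvalue of `|x|`, the eigenvalues
being listed in decreasing order and repeated according to multiplicity (and followed by zeros when
there are only finitely many positive ones). -/
noncomputable def singularValue (x : H →L[ℂ] H) (n : ℕ) : ℝ :=
  sInf {s : ℝ | 0 < s ∧ Module.rank ℂ (topSpace x s) ≤ n}

theorem topSpace_anti (x : H →L[ℂ] H) {s t : ℝ} (h : s ≤ t) : topSpace x t ≤ topSpace x s := by
  refine iSup_le fun μ => ?_
  exact le_iSup (fun μ : Set.Ioi s =>
    Module.End.eigenspace ((CFC.abs x : H →L[ℂ] H) : H →ₗ[ℂ] H) ((μ : ℝ) : ℂ)) ⟨μ.1, lt_of_le_of_lt h μ.2⟩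

theorem abs_isPositive (x : H →L[ℂ] H) : (CFC.abs x).IsPositive :=
  (ContinuousLinearMap.nonneg_iff_isPositive _).1 (CFC.abs_nonneg x)

theorem abs_abs_apply (x : H →L[ℂ] H) (v : H) :
    CFC.abs x (CFC.abs x v) = (ContinuousLinearMap.adjoint x) (x v) := by
  have := congrArg (fun f : H →L[ℂ] H => f v) (CFC.abs_mul_abs x)
  simpa [ContinuousLinearMap.star_eq_adjoint] using this

theorem norm_abs_apply (x : H →L[ℂ] H) (v : H) : ‖CFC.abs x v‖ = ‖x v‖ := by
  have h1 : inner ℂ (CFC.abs x v) (CFC.abs x v) = inner ℂ (x v) (x v) := by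
    have := (abs_isPositive x).isSymmetric v (CFC.abs x v)
    have h2 := abs_abs_apply x v
    simp only [ContinuousLinearMap.coe_coe] at this
    rw [this, h2, ContinuousLinearMap.adjoint_inner_right]
  rw [inner_self_eq_norm_sq_to_K, inner_self_eq_norm_sq_to_K] at h1
  have h3 : ‖CFC.abs x v‖ ^ 2 = ‖x v‖ ^ 2 := by exact_mod_cast h1
  exact (sq_eq_sq₀ (norm_nonneg _) (norm_nonneg _)).1 h3

theorem lt_norm_of_mem_topSpace (x : H →L[ℂ] H) {s : ℝ} (hs : 0 ≤ s) {v : H}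
    (hv : v ∈ topSpace x s) (h0 : v ≠ 0) : s * ‖v‖ < ‖x v‖ := by
  have hsym := (abs_isPositive x).isSymmetric
  have hof := hsym.orthogonalFamily_eigenspaces.comp
    (γ := Set.Ioi s) (f := fun μ => ((μ : ℝ) : ℂ))
    (fun a b h => Subtype.ext (Complex.ofReal_injective h))
  obtain ⟨f, hf, rfl⟩ := (Submodule.mem_iSup_iff_exists_finsupp _ _).1 hv
  rw [← norm_abs_apply]
  have e1 := hof.norm_sum (fun μ => ⟨f μ, hf μ⟩) f.support
  have e2 := hof.norm_sum (fun μ => ((μ : ℝ) : ℂ) • ⟨f μ, hf μ⟩) f.support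
  simp only [Submodule.coe_subtypeₗᵢ, Submodule.subtype_apply, Submodule.coe_smul, Submodule.coe_norm, norm_smul,
    Complex.norm_real, mul_pow] at e1 e2
  have e3 : CFC.abs x (f.sum fun _ m => m) = ∑ i ∈ f.support, ((i : ℝ) : ℂ) • f i := by
    rw [Finsupp.sum, map_sum]
    refine Finset.sum_congr rfl fun i _ => ?_
    exact Module.End.mem_eigenspace_iff.1 (hf i)
  have hne : f.support.Nonempty := by
    by_contra h
    rw [Finset.not_nonempty_iff_eq_empty] at h
    exact h0 (by simp [Finsupp.sum, h])
  refine lt_of_pow_lt_pow_left₀ 2 (norm_nonneg _) ?_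
  rw [mul_pow, e3, e2, Finsupp.sum, e1, Finset.mul_sum]
  refine Finset.sum_lt_sum_of_nonempty hne fun i hi => ?_
  have h1 : f i ≠ 0 := Finsupp.mem_support_iff.1 hi
  have h2 : s < i := i.2
  have h3 : 0 < ‖f i‖ := norm_pos_iff.2 h1
  simp only [Real.norm_eq_abs, sq_abs]
  have : s ^ 2 < (i : ℝ) ^ 2 := pow_lt_pow_left₀ h2 hs (by norm_num)
  exact mul_lt_mul_of_pos_right this (by positivity)

theorem norm_le_of_mem_orthogonal {x : H →L[ℂ] H} (hx : IsCompactOperator x) {s : ℝ}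
    (hs : 0 ≤ s) {v : H} (hv : v ∈ (topSpace x s)ᗮ) : ‖x v‖ ≤ s * ‖v‖ := by
  set A : H →L[ℂ] H := ContinuousLinearMap.adjoint x * x with hA
  have hAc : IsCompactOperator A := hx.clm_comp (ContinuousLinearMap.adjoint x)
  have hAv : ∀ w, A w = CFC.abs x (CFC.abs x w) := fun w => by rw [abs_abs_apply]; rfl
  set K := (topSpace x s)ᗮ with hK
  have hTE : ∀ w ∈ topSpace x s, CFC.abs x w ∈ topSpace x s := by
    intro w hw
    obtain ⟨f, hf, rfl⟩ := (Submodule.mem_iSup_iff_exists_finsupp _ _).1 hw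
    rw [Finsupp.sum, map_sum]
    refine Submodule.sum_mem _ fun i _ => ?_
    have : CFC.abs x (f i) = ((i : ℝ) : ℂ) • f i := Module.End.mem_eigenspace_iff.1 (hf i)
    rw [this]
    exact Submodule.smul_mem _ _ (Submodule.mem_iSup_of_mem i (hf i))
  have hTK : ∀ w ∈ K, CFC.abs x w ∈ K := by
    intro w hw u hu
    have := (abs_isPositive x).isSymmetric u w
    simp only [ContinuousLinearMap.coe_coe] at this
    rw [← this]
    exact hw _ (hTE u hu)
  have hAK : ∀ w ∈ K, A w ∈ K := fun w hw => by rw [hAv]; exact hTK _ (hTK _ hw)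
  have hKc : IsClosed (K : Set H) := Submodule.isClosed_orthogonal _
  have : CompleteSpace K := hKc.completeSpace_coe
  let B : K →L[ℂ] K := (A.comp K.subtypeL).codRestrict K (fun w => hAK _ w.2)
  have hBc : IsCompactOperator B := (hAc.comp_clm K.subtypeL).codRestrict _ hKc
  have hBv : ∀ w : K, ((B w : K) : H) = A w := fun w => rfl
  have hBs : IsSelfAdjoint B := by
    rw [ContinuousLinearMap.isSelfAdjoint_iff_isSymmetric]
    intro u w
    change inner ℂ (A u) (w : H) = inner ℂ (u : H) (A w)
    simp only [hA, mul_apply_eq_comp, ContinuousLinearMap.adjoint_inner_left,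
      ContinuousLinearMap.adjoint_inner_right]
  have hB : ‖B‖ ≤ s ^ 2 := by
    by_contra hlt
    push Not at hlt
    have hB0 : 0 < ‖B‖ := lt_of_le_of_lt (sq_nonneg s) hlt
    have : Nontrivial K := by
      by_contra h
      rw [not_nontrivial_iff_subsingleton] at h
      have : B = 0 := by ext w; exact congrArg _ (Subsingleton.elim _ _)
      simp [this] at hB0
    obtain ⟨z, hz, hzn⟩ := spectrum.exists_nnnorm_eq_spectralRadius B
    rw [B.spectralRadius_eq_nnnorm hBs] at hzn
    have hzn' : ‖z‖ = ‖B‖ := by exact_mod_cast congrArg ENNReal.toReal hzn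
    have hz0 : z ≠ 0 := by rintro rfl; simp at hzn'; exact hB0.ne hzn'
    obtain ⟨w, hw⟩ := ((hBc.hasEigenvalue_iff_mem_spectrum hz0).2 hz).exists_hasEigenvector
    have hw0 : (w : H) ≠ 0 := fun h => hw.2 (Subtype.ext h)
    have hBw : A w = z • (w : H) := by
      rw [← hBv]; exact congrArg Subtype.val hw.apply_eq_smul
    have hin : inner ℂ (w : H) (A w) = ((‖x w‖ ^ 2 : ℝ) : ℂ) := by
      simp only [hA, mul_apply_eq_comp,
        ContinuousLinearMap.adjoint_inner_right]
      rw [inner_self_eq_norm_sq_to_K]; push_cast; rfl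
    have hwn : 0 < ‖(w : H)‖ := norm_pos_iff.2 hw0
    have hz' : z = ((‖x w‖ ^ 2 / ‖(w : H)‖ ^ 2 : ℝ) : ℂ) := by
      rw [hBw, inner_smul_right, inner_self_eq_norm_sq_to_K] at hin
      have : ((‖(w : H)‖ : ℝ) : ℂ) ≠ 0 := by exact_mod_cast hwn.ne'
      push_cast at hin ⊢
      rw [eq_div_iff (by exact pow_ne_zero 2 this)]
      exact hin
    set r : ℝ := ‖x w‖ / ‖(w : H)‖ with hr
    have hr0 : 0 ≤ r := by positivity
    have hzr : z = ((r ^ 2 : ℝ) : ℂ) := by rw [hz', hr, div_pow]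
    have hrB : r ^ 2 = ‖B‖ := by rw [← hzn', hzr, Complex.norm_real]; simp
    have hsr : s < r := by
      refine lt_of_pow_lt_pow_left₀ 2 hr0 ?_
      rw [hrB]; exact hlt
    have hr0' : 0 < r := lt_of_le_of_lt hs hsr
    set T := CFC.abs x with hT
    set u : H := T w - (r : ℂ) • (w : H) with hu
    have hTu : T u = -((r : ℂ) • u) := by
      rw [hu, map_sub, map_smul, ← hAv, hBw, hzr]
      push_cast
      module
    have hu0 : u = 0 := by
      have h1 := (abs_isPositive x).re_inner_nonneg_right u
      rw [← hT, hTu, inner_neg_right, inner_smul_right, inner_self_eq_norm_sq_to_K] at h1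
      have h2 : 0 ≤ -(r * ‖u‖ ^ 2) := by
        have : -((r : ℂ) * ((‖u‖ : ℝ) : ℂ) ^ 2) = ((-(r * ‖u‖ ^ 2) : ℝ) : ℂ) := by push_cast; rfl
        erw [this] at h1
        simpa only [RCLike.re_to_complex, Complex.ofReal_re] using h1
      have h3 : ‖u‖ ^ 2 ≤ 0 := by
        by_contra h
        push Not at h
        nlinarith [mul_pos hr0' h]
      have : ‖u‖ = 0 := by nlinarith [norm_nonneg u]
      exact norm_eq_zero.1 this
    have hmem : (w : H) ∈ topSpace x s := by
      refine Submodule.mem_iSup_of_mem ⟨r, hsr⟩ ?_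
      rw [Module.End.mem_eigenspace_iff]
      exact sub_eq_zero.1 hu0
    exact hw0 (inner_self_eq_zero.1 (w.2 _ hmem))
  have h1 : ‖x v‖ ^ 2 ≤ s ^ 2 * ‖v‖ ^ 2 := by
    have h2 : ‖A v‖ ≤ ‖B‖ * ‖v‖ := B.le_opNorm ⟨v, hv⟩
    have h3 : inner ℂ v (A v) = ((‖x v‖ ^ 2 : ℝ) : ℂ) := by
      simp only [hA, mul_apply_eq_comp, ContinuousLinearMap.adjoint_inner_right]
      rw [inner_self_eq_norm_sq_to_K]; push_cast; rfl
    have h4 := norm_inner_le_norm (𝕜 := ℂ) v (A v)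
    rw [h3, Complex.norm_real] at h4
    simp only [norm_pow, norm_norm] at h4
    calc ‖x v‖ ^ 2 ≤ ‖v‖ * ‖A v‖ := h4
      _ ≤ ‖v‖ * (s ^ 2 * ‖v‖) := by gcongr; exact h2.trans (by gcongr)
      _ = _ := by ring
  rw [← mul_pow] at h1
  exact le_of_sq_le_sq h1 (by positivity)

theorem singularValue_le (z : H →L[ℂ] H) (n : ℕ) {r : ℝ} (hr : 0 < r) (F : Submodule ℂ H)
    (hF : Module.rank ℂ F ≤ n) (h : ∀ v ∈ Fᗮ, ‖z v‖ ≤ r * ‖v‖) : singularValue z n ≤ r := by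
  refine csInf_le ⟨0, fun s hs => hs.1.le⟩ ⟨hr, ?_⟩
  have : FiniteDimensional ℂ F :=
    Module.rank_lt_aleph0_iff.1 (lt_of_le_of_lt hF (Cardinal.natCast_lt_aleph0))
  change Module.rank ℂ (topSpace z r) ≤ n
  refine le_trans ?_ hF
  let P : topSpace z r →ₗ[ℂ] F := (F.orthogonalProjectionOnto : H →ₗ[ℂ] F).comp (topSpace z r).subtype
  refine LinearMap.rank_le_of_injective P ?_
  rw [← LinearMap.ker_eq_bot, LinearMap.ker_eq_bot']
  intro v hv
  by_contra hne
  have hvF : (v : H) ∈ Fᗮ := by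
    rw [← Submodule.orthogonalProjectionOnto_eq_zero_iff]; exact hv
  have h1 := lt_norm_of_mem_topSpace z hr.le v.2 (fun h => hne (Subtype.ext h))
  exact absurd (h _ hvF) (not_le.2 h1)

theorem singularValue_nonneg (x : H →L[ℂ] H) (n : ℕ) : 0 ≤ singularValue x n :=
  Real.sInf_nonneg fun _ h => h.1.le

theorem rank_topSpace_le {x : H →L[ℂ] H} {n : ℕ} {s : ℝ} (h : singularValue x n < s) :
    Module.rank ℂ (topSpace x s) ≤ n := by
  have hne : {s : ℝ | 0 < s ∧ Module.rank ℂ (topSpace x s) ≤ n}.Nonempty := by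
    refine ⟨‖x‖ + 1, by positivity, ?_⟩
    have : topSpace x (‖x‖ + 1) = ⊥ := by
      rw [eq_bot_iff]
      intro v hv
      by_contra hne
      have h1 := lt_norm_of_mem_topSpace x (by positivity) hv hne
      have h2 := x.le_opNorm v
      nlinarith [norm_nonneg v]
    rw [this, rank_bot]
    exact zero_le
  obtain ⟨t, ht, hts⟩ := exists_lt_of_csInf_lt hne h
  exact (Submodule.rank_mono (topSpace_anti x hts.le)).trans ht.2

theorem singularValue_antitone (x : H →L[ℂ] H) : Antitone (singularValue x) := by
  intro m n hmn
  refine le_of_forall_gt_imp_ge_of_dense fun s hs => ?_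
  refine csInf_le ⟨0, fun s hs => hs.1.le⟩
    ⟨(singularValue_nonneg x m).trans_lt hs, (rank_topSpace_le hs).trans ?_⟩
  exact_mod_cast hmn

theorem singularValue_zero (n : ℕ) : singularValue (0 : H →L[ℂ] H) n = 0 := by
  refine le_antisymm ?_ (singularValue_nonneg _ _)
  refine le_of_forall_gt_imp_ge_of_dense fun s hs => ?_
  exact singularValue_le _ n hs ⊥ (by simp) (fun v _ => by simp; positivity)

theorem singularValue_mul_le (b : H →L[ℂ] H) {x : H →L[ℂ] H} (hx : IsCompactOperator x) (n : ℕ) :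
    singularValue (b * x) n ≤ (‖b‖ + 1) * singularValue x n := by
  have hb : 0 < ‖b‖ + 1 := by positivity
  rw [mul_comm, ← div_le_iff₀ hb]
  refine le_of_forall_gt_imp_ge_of_dense fun s hs => ?_
  have hs0 := (singularValue_nonneg x n).trans_lt hs
  rw [div_le_iff₀ hb]
  refine singularValue_le _ n (by positivity) _ (rank_topSpace_le hs) fun v hv => ?_
  calc ‖b (x v)‖ ≤ ‖b‖ * ‖x v‖ := b.le_opNorm _
    _ ≤ (‖b‖ + 1) * (s * ‖v‖) := by
      gcongr
      · linarith
      · exact norm_le_of_mem_orthogonal hx hs0.le hv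
    _ = _ := by ring

theorem singularValue_add_le {x y : H →L[ℂ] H} (hx : IsCompactOperator x)
    (hy : IsCompactOperator y) (n : ℕ) :
    singularValue (x + y) n ≤ singularValue x (n / 2) + singularValue y (n / 2) := by
  refine le_of_forall_pos_le_add fun ε hε => ?_
  have h1 : singularValue x (n / 2) < singularValue x (n / 2) + ε / 2 := by linarith
  have h2 : singularValue y (n / 2) < singularValue y (n / 2) + ε / 2 := by linarith
  have p1 := (singularValue_nonneg x (n / 2)).trans_lt h1
  have p2 := (singularValue_nonneg y (n / 2)).trans_lt h2
  have key := singularValue_le (x + y) n (add_pos p1 p2)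
    (topSpace x (singularValue x (n / 2) + ε / 2) ⊔ topSpace y (singularValue y (n / 2) + ε / 2))
    (by
      refine (Submodule.rank_add_le_rank_add_rank _ _).trans
        ((add_le_add (rank_topSpace_le h1) (rank_topSpace_le h2)).trans ?_)
      have : n / 2 + n / 2 ≤ n := by omega
      exact_mod_cast this)
    (fun v hv => by
      have v1 := Submodule.orthogonal_le le_sup_left hv
      have v2 := Submodule.orthogonal_le le_sup_right hv
      have b1 := norm_le_of_mem_orthogonal hx p1.le v1
      have b2 := norm_le_of_mem_orthogonal hy p2.le v2
      calc ‖x v + y v‖ ≤ ‖x v‖ + ‖y v‖ := norm_add_le _ _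
        _ ≤ _ := by rw [add_mul]; exact add_le_add b1 b2)
  linarith

end

/-! ### Sequence spaces -/

/-- The decreasing rearrangement `ξ*` of `|ξ|`, for a bounded real sequence `ξ`:
`ξ*_n = inf {s > 0 : #{k : |ξ_k| > s} ≤ n}`, `n = 0, 1, 2, …`. -/
noncomputable def rearr (ξ : ℕ → ℝ) (n : ℕ) : ℝ :=
  sInf {s : ℝ | 0 < s ∧ {k : ℕ | s < |ξ k|}.encard ≤ n}

/-- The `l_p` norm `(∑ |ξ_n|^p)^(1/p)`, with value `∞` allowed. -/
noncomputable def lpNorm (p : ℝ) (ξ : ℕ → ℝ) : ℝ≥0∞ :=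
  (∑' n, ENNReal.ofReal (|ξ n| ^ p)) ^ (1 / p)

/-- The Lorentz norm `(∑ (ξ*_n)^p ω_n)^(1/p)`, with value `∞` allowed. -/
noncomputable def lorentzNorm (p : ℝ) (ω : ℕ → ℝ) (ξ : ℕ → ℝ) : ℝ≥0∞ :=
  (∑' n, ENNReal.ofReal (rearr ξ n ^ p * ω n)) ^ (1 / p)

/-- The Marcinkiewicz norm: the supremum over `k ≥ 1` of
`((∑_{n ≤ k} (ξ*_n)^p) / (∑_{n ≤ k} ω_n))^(1/p)` (sums of `k` terms), with value `∞` allowed. -/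
noncomputable def marcinkiewiczNorm (p : ℝ) (ω : ℕ → ℝ) (ξ : ℕ → ℝ) : ℝ≥0∞ :=
  ⨆ k : ℕ, ENNReal.ofReal
    (((∑ n ∈ Finset.range (k + 1), rearr ξ n ^ p) / ∑ n ∈ Finset.range (k + 1), ω n) ^ (1 / p))

/-- The space of all null sequences at which the extended norm `N` is finite. -/
def seqSpace (N : (ℕ → ℝ) → ℝ≥0∞) : Set (ℕ → ℝ) :=
  {ξ | Tendsto ξ atTop (𝓝 0) ∧ N ξ < ∞}

/-- A weight: a decreasing sequence of positive numbers with divergent sum. -/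
structure IsWeight (ω : ℕ → ℝ) : Prop where
  pos : ∀ n, 0 < ω n
  antitone : Antitone ω
  tendsto_sum : Tendsto (fun k => ∑ n ∈ Finset.range k, ω n) atTop atTop

/-! ### Operator ideals -/

/-- `C_E`: the compact operators whose sequence of singular values belongs to `E`. -/
def opClass (H : Type*) [NormedAddCommGroup H] [InnerProductSpace ℂ H] [CompleteSpace H]
    (E : Set (ℕ → ℝ)) : Set (H →L[ℂ] H) :=
  {x | IsCompactOperator x ∧ singularValue x ∈ E}

/-- The closure properties of `E` used to see that `C_E` is an algebra. -/
structure Admissible (E : Set (ℕ → ℝ)) : Prop where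
  zero_mem : (0 : ℕ → ℝ) ∈ E
  dom_mem : ∀ (c : ℝ) (u v w : ℕ → ℝ), 0 ≤ c → u ∈ E → v ∈ E → Antitone u → Antitone v →
    Antitone w → 0 ≤ u → 0 ≤ v → 0 ≤ w → (∀ n, w n ≤ c * (u (n / 2) + v (n / 2))) → w ∈ E

theorem mul_mem_opClass {H : Type*} [NormedAddCommGroup H] [InnerProductSpace ℂ H]
    [CompleteSpace H] {E : Set (ℕ → ℝ)} (hE : Admissible E) (b : H →L[ℂ] H) {x : H →L[ℂ] H}
    (hx : x ∈ opClass H E) : b * x ∈ opClass H E := by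
  refine ⟨hx.1.clm_comp b, hE.dom_mem (‖b‖ + 1) _ _ _ (by positivity) hx.2 hx.2
    (singularValue_antitone x) (singularValue_antitone x) (singularValue_antitone _)
    (singularValue_nonneg x) (singularValue_nonneg x) (singularValue_nonneg _) fun n => ?_⟩
  refine (singularValue_mul_le b hx.1 n).trans ?_
  have h1 := singularValue_antitone x (Nat.div_le_self n 2)
  have h2 := singularValue_nonneg x (n / 2)
  gcongr
  linarith

/-- `C_E` as an algebra of operators. -/
def opIdeal (H : Type*) [NormedAddCommGroup H] [InnerProductSpace ℂ H] [CompleteSpace H]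
    (E : Set (ℕ → ℝ)) (hE : Admissible E) : NonUnitalSubalgebra ℂ (H →L[ℂ] H) where
  carrier := opClass H E
  zero_mem' := ⟨isCompactOperator_zero, by
    rw [show singularValue (0 : H →L[ℂ] H) = 0 from funext singularValue_zero]
    exact hE.zero_mem⟩
  add_mem' := fun {x y} hx hy => ⟨hx.1.add hy.1, hE.dom_mem 1 _ _ _ zero_le_one hx.2 hy.2
    (singularValue_antitone x) (singularValue_antitone y) (singularValue_antitone _)
    (singularValue_nonneg x) (singularValue_nonneg y) (singularValue_nonneg _) fun n => by
      rw [one_mul]; exact singularValue_add_le hx.1 hy.1 n⟩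
  mul_mem' := fun {x _} _ hy => mul_mem_opClass hE x hy
  smul_mem' := fun c x hx => by
    have := mul_mem_opClass hE (c • (1 : H →L[ℂ] H)) hx
    simpa using this

theorem rearr_eq_self {u : ℕ → ℝ} (hu : Antitone u) (h0 : 0 ≤ u) : rearr u = u := by
  funext n
  have key : ∀ s : ℝ, {k : ℕ | s < |u k|}.encard ≤ n ↔ u n ≤ s := by
    intro s
    constructor
    · intro h
      by_contra hlt
      push Not at hlt
      have hsub : ((Finset.range (n + 1) : Finset ℕ) : Set ℕ) ⊆ {k : ℕ | s < |u k|} := by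
        intro k hk
        have hk' : k ≤ n := by simpa [Nat.lt_succ_iff] using hk
        exact (hlt.trans_le (hu hk')).trans_le (le_abs_self _)
      have h1 := (Set.encard_le_encard hsub).trans h
      rw [Set.encard_coe_eq_coe_finsetCard, Finset.card_range] at h1
      have : n + 1 ≤ n := by exact_mod_cast h1
      omega
    · intro h
      have hsub : {k : ℕ | s < |u k|} ⊆ ((Finset.range n : Finset ℕ) : Set ℕ) := by
        intro k hk
        by_contra hkn
        have hk' : n ≤ k := by simpa using hkn
        have : |u k| ≤ s := by rw [abs_of_nonneg (h0 k)]; exact (hu hk').trans h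
        exact absurd hk (not_lt.2 this)
      have h1 := Set.encard_le_encard hsub
      rwa [Set.encard_coe_eq_coe_finsetCard, Finset.card_range] at h1
  unfold rearr
  simp only [key]
  refine le_antisymm ?_ (le_csInf ⟨u n + 1, by have := h0 n; simp at this; positivity, by simp⟩
    fun s hs => hs.2)
  refine le_of_forall_gt_imp_ge_of_dense fun s hs => ?_
  exact csInf_le ⟨0, fun s hs => hs.1.le⟩ ⟨(h0 n).trans_lt hs, hs.le⟩

theorem tendsto_of_dom {c : ℝ} {u v w : ℕ → ℝ} (hu : Tendsto u atTop (𝓝 0))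
    (hv : Tendsto v atTop (𝓝 0)) (hw : 0 ≤ w) (h : ∀ n, w n ≤ c * (u (n / 2) + v (n / 2))) :
    Tendsto w atTop (𝓝 0) := by
  have hd : Tendsto (fun n : ℕ => n / 2) atTop atTop :=
    Nat.tendsto_div_const_atTop (by norm_num)
  have := ((hu.comp hd).add (hv.comp hd)).const_mul c
  simp only [add_zero, mul_zero] at this
  exact squeeze_zero hw h this

theorem tsum_half (f : ℕ → ℝ≥0∞) : ∑' n, f (n / 2) = 2 * ∑' n, f n := by
  rw [← tsum_even_add_odd (f := fun n => f (n / 2)) ENNReal.summable ENNReal.summable, two_mul]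
  congr 1
  · congr 1; funext k; congr 1; omega
  · congr 1; funext k; congr 1; omega

theorem tsum_dom_lt_top {p : ℝ} (hp : 1 ≤ p) {ω : ℕ → ℝ} (hω : Antitone ω) (hω0 : 0 ≤ ω)
    {c : ℝ} (hc : 0 ≤ c) {u v w : ℕ → ℝ} (hu0 : 0 ≤ u) (hv0 : 0 ≤ v) (hw0 : 0 ≤ w)
    (h : ∀ n, w n ≤ c * (u (n / 2) + v (n / 2)))
    (hu : ∑' n, ENNReal.ofReal (u n ^ p * ω n) < ∞)
    (hv : ∑' n, ENNReal.ofReal (v n ^ p * ω n) < ∞) :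
    ∑' n, ENNReal.ofReal (w n ^ p * ω n) < ∞ := by
  have hp0 : 0 ≤ p := zero_le_one.trans hp
  have h2 : ∀ a b : ℝ, 0 ≤ a → 0 ≤ b → (a + b) ^ p ≤ 2 ^ p * (a ^ p + b ^ p) := by
    intro a b ha hb
    have : (a + b) ^ p ≤ (2 * max a b) ^ p := by
      refine Real.rpow_le_rpow (by positivity) ?_ hp0
      linarith [le_max_left a b, le_max_right a b]
    refine this.trans ?_
    rw [Real.mul_rpow (by norm_num) (by positivity)]
    refine mul_le_mul_of_nonneg_left ?_ (by positivity)
    have ha' := Real.rpow_nonneg ha p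
    have hb' := Real.rpow_nonneg hb p
    rcases max_choice a b with h | h <;> rw [h] <;> linarith
  set g : ℕ → ℝ≥0∞ := fun n => ENNReal.ofReal (c ^ p * 2 ^ p) *
    (ENNReal.ofReal (u n ^ p * ω n) + ENNReal.ofReal (v n ^ p * ω n)) with hg
  have hle : ∀ n, ENNReal.ofReal (w n ^ p * ω n) ≤ g (n / 2) := by
    intro n
    have a0 := hu0 (n / 2)
    have b0 := hv0 (n / 2)
    have o0 := hω0 (n / 2)
    have hA := Real.rpow_nonneg a0 p
    have hB := Real.rpow_nonneg b0 p
    simp only [Pi.zero_apply] at a0 b0 o0 hA hB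
    rw [hg]
    simp only
    rw [← ENNReal.ofReal_add (mul_nonneg hA o0) (mul_nonneg hB o0),
      ← ENNReal.ofReal_mul (by positivity)]
    refine ENNReal.ofReal_le_ofReal ?_
    calc w n ^ p * ω n ≤ (c * (u (n / 2) + v (n / 2))) ^ p * ω (n / 2) := by
          refine mul_le_mul (Real.rpow_le_rpow (hw0 n) (h n) hp0) (hω (Nat.div_le_self n 2))
            (hω0 n) (by positivity)
      _ = c ^ p * (u (n / 2) + v (n / 2)) ^ p * ω (n / 2) := by
          rw [Real.mul_rpow hc (by positivity)]
      _ ≤ c ^ p * (2 ^ p * (u (n / 2) ^ p + v (n / 2) ^ p)) * ω (n / 2) := by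
          gcongr
          exact h2 _ _ a0 b0
      _ = _ := by ring
  refine (ENNReal.tsum_le_tsum hle).trans_lt ?_
  rw [tsum_half, hg, ENNReal.tsum_mul_left, ENNReal.tsum_add]
  exact ENNReal.mul_lt_top (by simp)
    (ENNReal.mul_lt_top (by simp) (ENNReal.add_lt_top.2 ⟨hu, hv⟩))

theorem admissible_lorentz {p : ℝ} (hp : 1 ≤ p) {ω : ℕ → ℝ} (hω : IsWeight ω) :
    Admissible (seqSpace (lorentzNorm p ω)) where
  zero_mem := by
    refine ⟨tendsto_const_nhds, ?_⟩
    have hp0 : p ≠ 0 := by positivity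
    rw [lorentzNorm, show rearr 0 = 0 from rearr_eq_self (fun _ _ _ => le_rfl) le_rfl]
    simp [Real.zero_rpow hp0, zero_lt_one.trans_le hp]
  dom_mem := by
    intro c u v w hc hu hv au av aw u0 v0 w0 h
    have hp0 : 0 < 1 / p := by positivity
    refine ⟨tendsto_of_dom hu.1 hv.1 w0 h, ?_⟩
    have h1 := hu.2
    have h2 := hv.2
    rw [lorentzNorm, ENNReal.rpow_lt_top_iff_of_pos hp0] at h1 h2 ⊢
    rw [rearr_eq_self au u0] at h1
    rw [rearr_eq_self av v0] at h2
    rw [rearr_eq_self aw w0]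
    exact tsum_dom_lt_top hp hω.antitone (fun n => (hω.pos n).le) hc u0 v0 w0 h h1 h2

theorem admissible_lp {p : ℝ} (hp : 1 ≤ p) : Admissible (seqSpace (lpNorm p)) where
  zero_mem := by
    refine ⟨tendsto_const_nhds, ?_⟩
    have hp0 : p ≠ 0 := by positivity
    rw [lpNorm]
    simp [Real.zero_rpow hp0, zero_lt_one.trans_le hp]
  dom_mem := by
    intro c u v w hc hu hv au av aw u0 v0 w0 h
    have hp0 : 0 < 1 / p := by positivity
    refine ⟨tendsto_of_dom hu.1 hv.1 w0 h, ?_⟩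
    have h1 := hu.2
    have h2 := hv.2
    rw [lpNorm, ENNReal.rpow_lt_top_iff_of_pos hp0] at h1 h2 ⊢
    simp only [abs_of_nonneg (u0 _), abs_of_nonneg (v0 _), abs_of_nonneg (w0 _)] at h1 h2 ⊢
    have := tsum_dom_lt_top hp (ω := fun _ => 1) antitone_const (fun _ => zero_le_one) hc
      u0 v0 w0 h (by simpa using h1) (by simpa using h2)
    simpa using this

/-- The ideal `C_{l_ω^p}` associated with the Lorentz sequence space `l_ω^p`. -/
noncomputable def lorentzIdeal (H : Type*) [NormedAddCommGroup H] [InnerProductSpace ℂ H]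
    [CompleteSpace H] {p : ℝ} (hp : 1 ≤ p) {ω : ℕ → ℝ} (hω : IsWeight ω) :
    NonUnitalSubalgebra ℂ (H →L[ℂ] H) :=
  opIdeal H (seqSpace (lorentzNorm p ω)) (admissible_lorentz hp hω)

/-- The Schatten ideal `C_p`. -/
noncomputable def schattenIdeal (H : Type*) [NormedAddCommGroup H] [InnerProductSpace ℂ H]
    [CompleteSpace H] {p : ℝ} (hp : 1 ≤ p) : NonUnitalSubalgebra ℂ (H →L[ℂ] H) :=
  opIdeal H (seqSpace (lpNorm p)) (admissible_lp hp)

section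
variable {H : Type*} [NormedAddCommGroup H] [InnerProductSpace ℂ H] [CompleteSpace H]

/-- The norm `‖x‖_{C_E} = ‖(s_n(x))‖_E`, where `N` is the norm of `E`. -/
noncomputable def opNorm (N : (ℕ → ℝ) → ℝ≥0∞) (x : H →L[ℂ] H) : ℝ≥0∞ := N (singularValue x)

/-- A linear map `δ : I → J` is a derivation if `δ(xy) = δ(x) y + x δ(y)` for `x, y ∈ I`. -/
def IsDerivation {I J : NonUnitalSubalgebra ℂ (H →L[ℂ] H)} (δ : I →ₗ[ℂ] J) : Prop :=
  ∀ x y : I, (δ (x * y) : H →L[ℂ] H) =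
    (δ x : H →L[ℂ] H) * (y : H →L[ℂ] H) + (x : H →L[ℂ] H) * (δ y : H →L[ℂ] H)

/-- The `J`-dual space `J : I` of `I`: all bounded `a` with `a x ∈ J` for every `x ∈ I`. -/
def dualSpace (J I : NonUnitalSubalgebra ℂ (H →L[ℂ] H)) : Set (H →L[ℂ] H) :=
  {a | ∀ x ∈ I, a * x ∈ J}

/-- `‖a‖_{J:I} = sup {‖a x‖_J : x ∈ I, ‖x‖_I ≤ 1}`, where `‖·‖_J` and `‖·‖_I` are induced by
the sequence norms `NJ` and `NI`. -/
noncomputable def dualNorm (NJ NI : (ℕ → ℝ) → ℝ≥0∞) (I : NonUnitalSubalgebra ℂ (H →L[ℂ] H))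
    (a : H →L[ℂ] H) : ℝ≥0∞ :=
  ⨆ (x : I) (_ : opNorm NI (x : H →L[ℂ] H) ≤ 1), opNorm NJ (a * (x : H →L[ℂ] H))

/-- `‖δ‖ = sup {‖δ(x)‖_J : x ∈ I, ‖x‖_I ≤ 1}` for a linear map `δ : I → J`, where `‖·‖_J` and
`‖·‖_I` are induced by the sequence norms `NJ` and `NI`. -/
noncomputable def mapNorm (NJ NI : (ℕ → ℝ) → ℝ≥0∞) {I J : NonUnitalSubalgebra ℂ (H →L[ℂ] H)}
    (δ : I →ₗ[ℂ] J) : ℝ≥0∞ :=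
  ⨆ (x : I) (_ : opNorm NI (x : H →L[ℂ] H) ≤ 1), opNorm NJ (δ x : H →L[ℂ] H)

end

end SymmIdeal

open SymmIdeal

-- The commutator with any `a` is a derivation, and the norm bounds rest on `s_{m+n}(ax) ≤ s_m(a)
-- s_n(x)` (indices from 0). With `m = n` every product `s_n(a) s_n(x)` is used twice, so `∑
-- s_n(ax)^p ≤ 2 ∑ s_n(a)^p s_n(x)^p`. Abel summation turns the Marcinkiewicz bound on the partial
-- sums of `s_n(a)^p` into the Lorentz sum of `x`, and `2^(1/p) ≤ 2` (`opNorm_mul_le`). The product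
-- `xa` is reduced to this case by adjoints and a polar decomposition (`opNorm_mul_le_dualNorm'`),
-- and the triangle inequality in `C_p` gives the bound for `ax - xa`.
--
-- Conversely, a derivation is determined by its values on rank-one operators. These define a linear
-- map `a` on `H`, bounded by the closed graph theorem, with `δ = δ_a`
-- (`exists_eq_commutator_of_isDerivation`). It remains to show that `a - l` lies in `C_{m^p_W}` for
-- some scalar `l`, since subtracting a scalar does not change `δ_a`.
--
-- Choose greedily pairs `e_n, f_n` of orthogonal unit vectors, orthogonal to all earlier ones, for
-- which the entry `⟪f_n, a e_n⟫` is within a factor 2 of the largest possible value `d_n`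
-- (`exists_greedy_sequence`). For `x` diagonal on `(e_n)` with entries `ξ_n`, the commutator has
-- the entries `ξ_n ⟪f_n, a e_n⟫`, and these are `l_p`-dominated by its singular values. So `(d_n)`
-- multiplies decreasing sequences of `l^p_ω` into `l_p`, and a condensation argument gives `∑_{n<k}
-- d_n^p ≤ M W_k` (`exists_sum_inner_rpow_le`). As `ω_n → 0`, also `d_n → 0`.
--
-- On the complement of the first `n` pairs all off-diagonal entries are at most `d_n`, so the
-- compression of `a` is within a multiple of `d_n` of a scalar (`norm_inner_sub_le_offDiag`). These
-- scalars converge to a limit `l`, and `s_{4n}(a - l) ≤ 12 d_n` follows, so `a - l` inherits the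
-- Marcinkiewicz bound (`exists_scalar_sub_mem`).

universe u

/-! ### Diagonalisation of `|x|` and the distribution of singular values. -/

section Spectral

variable {H : Type u} [NormedAddCommGroup H] [InnerProductSpace ℂ H] [CompleteSpace H]

/-- Orthonormal bases of the eigenspaces of `|x|`, the kernel included, are glued together.
Completeness is the spectral theorem for compact operators, here supplied by
`norm_le_of_mem_orthogonal` at level 0. -/
theorem exists_hilbertBasis_abs {x : H →L[ℂ] H} (hx : IsCompactOperator x) :
    ∃ (ι : Type u) (b : HilbertBasis ι ℂ H) (μ : ι → ℝ), (∀ i, 0 ≤ μ i) ∧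
      ∀ i, CFC.abs x (b i) = (μ i : ℂ) • b i := by
  set T : H →L[ℂ] H := CFC.abs x with hT
  have hsym := (abs_isPositive x).isSymmetric
  let V : ℝ → Submodule ℂ H := fun μ => Module.End.eigenspace (T : H →ₗ[ℂ] H) (μ : ℂ)
  have hof : OrthogonalFamily ℂ (fun μ : ℝ => V μ) fun μ => (V μ).subtypeₗᵢ :=
    hsym.orthogonalFamily_eigenspaces.comp (γ := ℝ) (f := fun μ => (μ : ℂ))
      Complex.ofReal_injective
  have hcl : ∀ μ, IsClosed (V μ : Set H) := by
    intro μ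
    have : (V μ : Set H) = {v | T v = (μ : ℂ) • v} := by
      ext v; exact Module.End.mem_eigenspace_iff
    rw [this]
    exact isClosed_eq (by fun_prop) (by fun_prop)
  have hcomp : ∀ μ, CompleteSpace (V μ) := fun μ => (hcl μ).completeSpace_coe
  choose w c hc using fun μ => exists_hilbertBasis ℂ (V μ)
  have hon : Orthonormal ℂ fun a : Σ μ : ℝ, w μ => ((c a.1 a.2 : V a.1) : H) :=
    hof.orthonormal_sigma_orthonormal fun μ => (c μ).orthonormal
  have heig : ∀ a : Σ μ : ℝ, w μ,
      T (c a.1 a.2 : V a.1) = (a.1 : ℂ) • ((c a.1 a.2 : V a.1) : H) :=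
    fun a => Module.End.mem_eigenspace_iff.1 (c a.1 a.2).2
  have hbot : (Submodule.span ℂ (Set.range fun a : Σ μ : ℝ, w μ =>
      ((c a.1 a.2 : V a.1) : H)))ᗮ = ⊥ := by
    rw [eq_bot_iff]
    intro v hv
    have hvV : ∀ μ, ∀ u ∈ V μ, inner ℂ u v = 0 := by
      intro μ u hu
      have h1 := ((c μ).hasSum_repr ⟨u, hu⟩).mapL ((V μ).subtypeL)
      have h2 := h1.mapL (innerSL ℂ v)
      have h3 : ∀ i, innerSL ℂ v ((V μ).subtypeL ((c μ).repr ⟨u, hu⟩ i • c μ i)) = 0 := by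
        intro i
        simp only [map_smul, innerSL_apply_apply, Submodule.subtypeL_apply]
        have : inner ℂ ((c μ i : V μ) : H) v = 0 :=
          hv _ (Submodule.subset_span ⟨⟨μ, i⟩, rfl⟩)
        rw [← inner_conj_symm, this]; simp
      simp only [h3] at h2
      have h4 := h2.unique hasSum_zero
      simp only [innerSL_apply_apply, Submodule.subtypeL_apply] at h4
      rw [← inner_conj_symm, h4]; simp
    -- A vector orthogonal to all eigenvectors is killed by `|x|`, so it lies in the eigenspace of 0
    -- and is orthogonal to itself.
    have hvt : v ∈ (topSpace x 0)ᗮ := by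
      rw [Submodule.mem_orthogonal]
      intro u hu
      obtain ⟨f, hf, rfl⟩ := (Submodule.mem_iSup_iff_exists_finsupp _ _).1 hu
      rw [Finsupp.sum, sum_inner]
      exact Finset.sum_eq_zero fun i _ => hvV i _ (hf i)
    have h0 := norm_le_of_mem_orthogonal hx le_rfl hvt
    rw [zero_mul, ← norm_abs_apply] at h0
    have h1 : T v = 0 := norm_le_zero_iff.1 h0
    have h2 : v ∈ V 0 := by
      refine Module.End.mem_eigenspace_iff.2 ?_
      simpa using h1
    exact (Submodule.mem_bot ℂ).2 (inner_self_eq_zero.1 (hvV 0 v h2))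
  refine ⟨Σ μ : ℝ, w μ, HilbertBasis.mkOfOrthogonalEqBot hon hbot, fun a => a.1, fun a => ?_,
    fun a => ?_⟩
  · have h1 := (abs_isPositive x).re_inner_nonneg_right ((c a.1 a.2 : V a.1) : H)
    rw [← hT, heig a, inner_smul_right, inner_self_eq_norm_sq_to_K, hon.1 a] at h1
    simpa using h1
  · rw [HilbertBasis.coe_mkOfOrthogonalEqBot]
    exact heig a

variable {x : H →L[ℂ] H} {ι : Type u} {b : HilbertBasis ι ℂ H} {μ : ι → ℝ}

theorem rank_topSpace_le_iff (hb : ∀ i, CFC.abs x (b i) = (μ i : ℂ) • b i) (t : ℝ) (n : ℕ) :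
    Module.rank ℂ (topSpace x t) ≤ n ↔ {i | t < μ i}.encard ≤ n := by
  constructor
  · intro h
    by_contra hlt
    push Not at hlt
    obtain ⟨S, hS, hSc⟩ := Set.exists_subset_encard_eq (k := (n + 1 : ℕ))
      (s := {i | t < μ i}) (by push_cast; exact Order.add_one_le_of_lt hlt)
    have hfin : S.Finite := Set.finite_of_encard_eq_coe hSc
    have := hfin.fintype
    have hmem : ∀ i : S, b i ∈ topSpace x t := fun i =>
      Submodule.mem_iSup_of_mem ⟨μ i, hS i.2⟩ (Module.End.mem_eigenspace_iff.2 (hb i))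
    have hli : LinearIndependent ℂ fun i : S => (⟨b i, hmem i⟩ : topSpace x t) := by
      have h1 : LinearIndependent ℂ fun i : S => b i :=
        (b.orthonormal.comp (fun i : S => (i : ι)) Subtype.val_injective).linearIndependent
      exact LinearIndependent.of_comp (topSpace x t).subtype h1
    have h2 := hli.cardinal_lift_le_rank.trans (Cardinal.lift_le.2 h)
    rw [Cardinal.mk_fintype, Cardinal.lift_natCast, Cardinal.lift_natCast] at h2
    have h3 : Fintype.card S ≤ n := by exact_mod_cast h2
    rw [Set.encard_eq_coe_toFinset_card, Set.toFinset_card] at hSc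
    have : Fintype.card S = n + 1 := by exact_mod_cast hSc
    omega
  · intro h
    have hfin : {i | t < μ i}.Finite := Set.finite_of_encard_le_coe h
    have hsub : topSpace x t ≤ Submodule.span ℂ (Set.range fun i : {i | t < μ i} => b i) := by
      refine iSup_le fun ν v hv => ?_
      have hv' : CFC.abs x v = ((ν : ℝ) : ℂ) • v := Module.End.mem_eigenspace_iff.1 hv
      have hz : ∀ i ∉ hfin.toFinset, b.repr v i • b i = 0 := by
        intro i hi
        have hi' : μ i ≠ ν := by
          intro h'
          exact hi (by simpa [h'] using Set.mem_Ioi.1 ν.2)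
        have h1 := (abs_isPositive x).isSymmetric (b i) v
        simp only [ContinuousLinearMap.coe_coe] at h1
        rw [hb, hv', inner_smul_left, inner_smul_right, Complex.conj_ofReal] at h1
        have h2 : ((μ i : ℂ) - ((ν : ℝ) : ℂ)) * inner ℂ (b i) v = 0 := by
          rw [sub_mul, h1, sub_self]
        have h3 : (μ i : ℂ) - ((ν : ℝ) : ℂ) ≠ 0 := by
          rw [sub_ne_zero]; exact_mod_cast hi'
        rw [b.repr_apply_apply, (mul_eq_zero.1 h2).resolve_left h3, zero_smul]
      rw [(b.hasSum_repr v).unique (hasSum_sum_of_ne_finset_zero hz)]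
      refine Submodule.sum_mem _ fun i hi => Submodule.smul_mem _ _ (Submodule.subset_span ?_)
      exact ⟨⟨i, by simpa using hi⟩, rfl⟩
    have h1 := Submodule.rank_mono hsub
    have h2 := rank_span_le (R := ℂ) (Set.range fun i : {i | t < μ i} => b i)
    have h5 : Cardinal.mk {i | t < μ i} ≤ n := by
      rw [← Cardinal.toENat_le_natCast]; exact h
    exact h1.trans (h2.trans (Cardinal.mk_range_le.trans h5))

theorem singularValue_le_iff (hb : ∀ i, CFC.abs x (b i) = (μ i : ℂ) • b i) {t : ℝ} (ht : 0 < t)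
    (n : ℕ) : singularValue x n ≤ t ↔ {i | t < μ i}.encard ≤ n := by
  constructor
  · intro h
    by_contra hlt
    push Not at hlt
    obtain ⟨S, hS, hSc⟩ := Set.exists_subset_encard_eq (k := (n + 1 : ℕ))
      (s := {i | t < μ i}) (by push_cast; exact Order.add_one_le_of_lt hlt)
    have hfin : S.Finite := Set.finite_of_encard_eq_coe hSc
    have hne : S.Nonempty := by
      rw [← Set.encard_ne_zero, hSc]; simp
    -- Finitely many eigenvalues above `t` stay above some `r > t`. The gap is needed because the
    -- singular value is an infimum and `rank_topSpace_le` asks for a strict inequality.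
    obtain ⟨i, hi, hmin⟩ := Set.exists_min_image S μ hfin hne
    obtain ⟨r, hr1, hr2⟩ := exists_between (by simpa using hS hi : t < μ i)
    have h1 := (rank_topSpace_le_iff hb r n).1 (rank_topSpace_le (h.trans_lt hr1))
    have h2 : S.encard ≤ {i | r < μ i}.encard :=
      Set.encard_le_encard fun j hj => hr2.trans_le (hmin j hj)
    rw [hSc] at h2
    have : n + 1 ≤ n := by exact_mod_cast h2.trans h1
    omega
  · intro h
    exact csInf_le ⟨0, fun s hs => hs.1.le⟩ ⟨ht, (rank_topSpace_le_iff hb t n).2 h⟩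

/-- The set on the left is the initial segment of all `n` below the cardinality on the right.
Equality of these distribution functions makes it unnecessary to enumerate the eigenvalues in
decreasing order. -/
theorem encard_lt_singularValue (hb : ∀ i, CFC.abs x (b i) = (μ i : ℂ) • b i) {t : ℝ}
    (ht : 0 < t) : {n | t < singularValue x n}.encard = {i | t < μ i}.encard := by
  have h : {n | t < singularValue x n} = {n : ℕ | (n : ℕ∞) < {i | t < μ i}.encard} := by
    ext n
    simp only [Set.mem_ofPred_eq]
    rw [← not_le, singularValue_le_iff hb ht, not_le]
  rw [h]
  generalize {i | t < μ i}.encard = c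
  induction c using ENat.recTopCoe with
  | top => simp
  | coe k =>
    have : {n : ℕ | (n : ℕ∞) < k} = ((Finset.range k : Finset ℕ) : Set ℕ) := by ext n; simp
    rw [this, Set.encard_coe_eq_coe_finsetCard, Finset.card_range]

/-- The layer-cake formula for counting measure expresses a sum of `p`-th powers through the
distribution function alone. -/
theorem tsum_rpow_eq_of_encard_eq {α β : Type*} {f : α → ℝ} {g : β → ℝ} (hf : ∀ i, 0 ≤ f i)
    (hg : ∀ i, 0 ≤ g i) (h : ∀ t, 0 < t → {i | t < f i}.encard = {i | t < g i}.encard) {p : ℝ}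
    (hp : 0 < p) : ∑' i, ENNReal.ofReal (f i ^ p) = ∑' i, ENNReal.ofReal (g i ^ p) := by
  let _ : MeasurableSpace α := ⊤
  let _ : MeasurableSpace β := ⊤
  rw [← MeasureTheory.lintegral_count, ← MeasureTheory.lintegral_count,
    MeasureTheory.lintegral_rpow_eq_lintegral_meas_lt_mul _ (MeasureTheory.ae_of_all _ hf)
      measurable_from_top.aemeasurable hp,
    MeasureTheory.lintegral_rpow_eq_lintegral_meas_lt_mul _ (MeasureTheory.ae_of_all _ hg)
      measurable_from_top.aemeasurable hp]
  congr 1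
  refine MeasureTheory.setLIntegral_congr_fun measurableSet_Ioi fun t ht => ?_
  rw [MeasureTheory.Measure.count_apply MeasurableSpace.measurableSet_top,
    MeasureTheory.Measure.count_apply MeasurableSpace.measurableSet_top, h t (Set.mem_Ioi.1 ht)]

theorem tsum_singularValue_rpow (h0 : ∀ i, 0 ≤ μ i)
    (hb : ∀ i, CFC.abs x (b i) = (μ i : ℂ) • b i) {p : ℝ} (hp : 0 < p) :
    ∑' n, ENNReal.ofReal (singularValue x n ^ p) = ∑' i, ENNReal.ofReal (μ i ^ p) :=
  tsum_rpow_eq_of_encard_eq (singularValue_nonneg x) h0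
    (fun _ ht => encard_lt_singularValue hb ht) hp

end Spectral

/-! ### Singular values of adjoints and products, and polar decomposition. -/

section SingularValues

variable {H : Type u} [NormedAddCommGroup H] [InnerProductSpace ℂ H]

theorem isCompactOperator_starProjection (F : Submodule ℂ H) [FiniteDimensional ℂ F] :
    IsCompactOperator F.starProjection := by
  have : ProperSpace F := FiniteDimensional.proper ℂ F
  exact (isCompactOperator_of_locallyCompactSpace_rng F.subtypeL).comp_clm
    F.orthogonalProjectionOnto

variable [CompleteSpace H]

local postfix:max "†" => ContinuousLinearMap.adjoint

/-- Unlike the factor `‖b‖ + 1` in `singularValue_mul_le`, the constant 1 is sharp. This is what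
keeps the dual norm unchanged when `ax` is replaced by `xa`. -/
theorem singularValue_mul_le_of_norm_le_one {c x : H →L[ℂ] H} (hc : ‖c‖ ≤ 1)
    (hx : IsCompactOperator x) (n : ℕ) : singularValue (c * x) n ≤ singularValue x n := by
  refine le_of_forall_gt_imp_ge_of_dense fun s hs => ?_
  have hs0 := (singularValue_nonneg x n).trans_lt hs
  refine singularValue_le _ n hs0 _ (rank_topSpace_le hs) fun v hv => ?_
  calc ‖c (x v)‖ ≤ 1 * ‖x v‖ := c.le_of_opNorm_le hc _
    _ ≤ s * ‖v‖ := by rw [one_mul]; exact norm_le_of_mem_orthogonal hx hs0.le hv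

/-- With `P` the projection onto `F`, `z` is the norm limit of the finite-rank operators `z P`, and
`z†` is the limit of their adjoints `P z†`. -/
theorem isCompactOperator_of_forall_exists_le {z : H →L[ℂ] H}
    (h : ∀ ε > 0, ∃ F : Submodule ℂ H, FiniteDimensional ℂ F ∧ ∀ v ∈ Fᗮ, ‖z v‖ ≤ ε * ‖v‖) :
    IsCompactOperator z ∧ IsCompactOperator (z†) := by
  choose F hF hz using fun n : ℕ => h (1 / ((n : ℝ) + 1)) (by positivity)
  have hle : ∀ n, ‖z * (F n).starProjection - z‖ ≤ 1 / ((n : ℝ) + 1) := by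
    intro n
    refine ContinuousLinearMap.opNorm_le_bound _ (by positivity) fun v => ?_
    have h1 : (z * (F n).starProjection - z) v = -z ((F n)ᗮ.starProjection v) := by
      rw [Submodule.starProjection_orthogonal_val]
      simp
    rw [h1, norm_neg]
    refine (hz n _ (Submodule.starProjection_apply_mem _ _)).trans ?_
    gcongr
    exact Submodule.norm_starProjection_apply_le _ _
  have ht : Tendsto (fun n => z * (F n).starProjection) atTop (𝓝 z) := by
    rw [tendsto_iff_norm_sub_tendsto_zero]
    exact squeeze_zero (fun _ => norm_nonneg _) hle tendsto_one_div_add_atTop_nhds_zero_nat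
  refine ⟨isCompactOperator_of_tendsto ht (.of_forall fun n =>
    (isCompactOperator_starProjection (F n)).clm_comp z), ?_⟩
  have ht' : Tendsto (fun n => (F n).starProjection * z†) atTop (𝓝 (z†)) := by
    have := (ContinuousLinearMap.adjoint (𝕜 := ℂ) (E := H) (F := H)).continuous.tendsto z
    refine (this.comp ht).congr fun n => ?_
    have h2 := (isSelfAdjoint_starProjection (F n)).adjoint_eq
    simp only [Function.comp_apply]
    rw [← ContinuousLinearMap.star_eq_adjoint, star_mul, ContinuousLinearMap.star_eq_adjoint,
      ContinuousLinearMap.star_eq_adjoint, h2]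
  exact isCompactOperator_of_tendsto ht' (.of_forall fun n =>
    (isCompactOperator_starProjection (F n)).comp_clm (z†))

theorem IsCompactOperator.adjoint_of_tendsto {x : H →L[ℂ] H} (hx : IsCompactOperator x)
    (h0 : Tendsto (singularValue x) atTop (𝓝 0)) : IsCompactOperator (x†) := by
  refine (isCompactOperator_of_forall_exists_le fun ε hε => ?_).2
  obtain ⟨n, hn⟩ := (h0.eventually_lt_const hε).exists
  exact ⟨topSpace x ε, Module.rank_lt_aleph0_iff.1
    ((rank_topSpace_le hn).trans_lt Cardinal.natCast_lt_aleph0),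
    fun v hv => norm_le_of_mem_orthogonal hx hε.le hv⟩

/-- If `v` is orthogonal to the image under `x` of the top space, then `x† v` is orthogonal to the
top space. Hence `‖x† v‖² = ⟪x x† v, v⟫ ≤ s ‖x† v‖ ‖v‖`. -/
theorem singularValue_adjoint_le {x : H →L[ℂ] H} (hx : IsCompactOperator x) (n : ℕ) :
    singularValue (x†) n ≤ singularValue x n := by
  refine le_of_forall_gt_imp_ge_of_dense fun s hs => ?_
  have hs0 := (singularValue_nonneg x n).trans_lt hs
  refine singularValue_le _ n hs0 ((topSpace x s).map (x : H →ₗ[ℂ] H))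
    ((rank_map_le _ _).trans (rank_topSpace_le hs)) fun v hv => ?_
  have h1 : x† v ∈ (topSpace x s)ᗮ := by
    rw [Submodule.mem_orthogonal]
    intro u hu
    rw [ContinuousLinearMap.adjoint_inner_right]
    exact hv _ (Submodule.mem_map_of_mem hu)
  have h2 := norm_le_of_mem_orthogonal hx hs0.le h1
  have h3 : ‖x† v‖ ^ 2 ≤ s * ‖v‖ * ‖x† v‖ := by
    have h4 : inner ℂ (x (x† v)) v = ((‖x† v‖ ^ 2 : ℝ) : ℂ) := by
      rw [← ContinuousLinearMap.adjoint_inner_right, inner_self_eq_norm_sq_to_K]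
      push_cast; rfl
    have h5 := norm_inner_le_norm (𝕜 := ℂ) (x (x† v)) v
    rw [h4, Complex.norm_real, Real.norm_of_nonneg (by positivity)] at h5
    refine h5.trans ((mul_le_mul_of_nonneg_right h2 (norm_nonneg v)).trans_eq (by ring))
  rcases (norm_nonneg (x† v)).eq_or_lt with h | h
  · rw [← h]; positivity
  · rw [pow_two] at h3
    exact le_of_mul_le_mul_right h3 h

theorem singularValue_adjoint {x : H →L[ℂ] H} (hx : IsCompactOperator x)
    (h0 : Tendsto (singularValue x) atTop (𝓝 0)) : singularValue (x†) = singularValue x := by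
  funext n
  refine le_antisymm (singularValue_adjoint_le hx n) ?_
  have := singularValue_adjoint_le (hx.adjoint_of_tendsto h0) n
  rwa [ContinuousLinearMap.adjoint_adjoint] at this

theorem singularValue_mul_le_mul {a x : H →L[ℂ] H} (ha : IsCompactOperator a)
    (hx : IsCompactOperator x) (m n : ℕ) :
    singularValue (a * x) (m + n) ≤ singularValue a m * singularValue x n := by
  have key : ∀ ε > (0 : ℝ), singularValue (a * x) (m + n) ≤
      (singularValue a m + ε) * (singularValue x n + ε) := by
    intro ε hε
    have hs : singularValue a m < singularValue a m + ε := by linarith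
    have ht : singularValue x n < singularValue x n + ε := by linarith
    have hs0 := (singularValue_nonneg a m).trans_lt hs
    have ht0 := (singularValue_nonneg x n).trans_lt ht
    -- Orthogonality to the second summand says exactly that `x v` is orthogonal to the top space of
    -- `a`, so the bounds for `x` at `v` and for `a` at `x v` multiply.
    refine singularValue_le _ _ (mul_pos hs0 ht0) (topSpace x (singularValue x n + ε) ⊔
      (topSpace a (singularValue a m + ε)).map (x† : H →ₗ[ℂ] H)) ?_ fun v hv => ?_
    · refine (Submodule.rank_add_le_rank_add_rank _ _).trans ?_
      rw [Nat.cast_add, add_comm]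
      exact add_le_add ((rank_map_le _ _).trans (rank_topSpace_le hs)) (rank_topSpace_le ht)
    · have v1 := Submodule.orthogonal_le le_sup_left hv
      have v2 := Submodule.orthogonal_le le_sup_right hv
      have v3 : x v ∈ (topSpace a (singularValue a m + ε))ᗮ := by
        rw [Submodule.mem_orthogonal]
        intro u hu
        rw [← ContinuousLinearMap.adjoint_inner_left]
        exact v2 _ (Submodule.mem_map_of_mem hu)
      calc ‖a (x v)‖ ≤ _ := norm_le_of_mem_orthogonal ha hs0.le v3
        _ ≤ _ := mul_le_mul_of_nonneg_left (norm_le_of_mem_orthogonal hx ht0.le v1) hs0.le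
        _ = _ := by ring
  have hc : Continuous fun ε : ℝ => (singularValue a m + ε) * (singularValue x n + ε) := by
    fun_prop
  have ht := (hc.tendsto 0).mono_left (nhdsWithin_le_nhds (s := Set.Ioi 0))
  simp only [add_zero] at ht
  exact ge_of_tendsto ht (eventually_nhdsWithin_of_forall fun ε hε => key ε hε)

/-- The map `B v ↦ A v` is a well-defined contraction on the range of `B`. It extends to the closure
by density and to `H` by projecting orthogonally. -/
theorem exists_contraction_mul_eq {A B : H →L[ℂ] H} (h : ∀ v, ‖A v‖ ≤ ‖B v‖) :
    ∃ c : H →L[ℂ] H, ‖c‖ ≤ 1 ∧ c * B = A := by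
  set K := (LinearMap.range (B : H →ₗ[ℂ] H)).topologicalClosure with hK
  have hmem : ∀ v, B v ∈ K := fun v => Submodule.le_topologicalClosure _ ⟨v, rfl⟩
  have : CompleteSpace K := (Submodule.isClosed_topologicalClosure _).completeSpace_coe
  let e : H →ₗ[ℂ] K := (B : H →ₗ[ℂ] H).codRestrict K hmem
  have he : DenseRange e := by
    intro y
    have hy : (y : H) ∈ closure (Set.range B) := y.2
    rw [closure_subtype]
    convert hy using 2
    ext z
    constructor
    · rintro ⟨_, ⟨v, rfl⟩, rfl⟩; exact ⟨v, rfl⟩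
    · rintro ⟨v, rfl⟩; exact ⟨e v, ⟨v, rfl⟩, rfl⟩
  have hn : ∀ v, ‖(A : H →ₗ[ℂ] H) v‖ ≤ 1 * ‖e v‖ := fun v => by rw [one_mul]; exact h v
  refine ⟨((A : H →ₗ[ℂ] H).extendOfNorm e).comp K.orthogonalProjectionOnto, ?_, ?_⟩
  · refine (ContinuousLinearMap.opNorm_comp_le _ _).trans ?_
    exact mul_le_one₀ (LinearMap.opNorm_extendOfNorm_le he zero_le_one hn) (norm_nonneg _)
      (Submodule.orthogonalProjectionOnto_norm_le _)
  · ext v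
    have h1 : K.orthogonalProjectionOnto (B v) = e v :=
      Submodule.orthogonalProjectionOnto_mem_subspace_eq_self (e v)
    change (A : H →ₗ[ℂ] H).extendOfNorm e (K.orthogonalProjectionOnto (B v)) = A v
    rw [h1, LinearMap.extendOfNorm_eq he ⟨1, hn⟩]
    rfl

/-- Since `‖a v‖ = ‖|a| v‖`, there are contractions with `c |a| = a` and `w a = |a|`. Therefore `a†
= |a| c† = w a c†`. This transfers right multiplication by `a` to left multiplication without loss
of norm. -/
theorem exists_adjoint_eq_mul_mul (a : H →L[ℂ] H) :
    ∃ w u : H →L[ℂ] H, ‖w‖ ≤ 1 ∧ ‖u‖ ≤ 1 ∧ a† = w * a * u := by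
  obtain ⟨c, hc, hca⟩ := exists_contraction_mul_eq (A := a) (B := CFC.abs a)
    fun v => (norm_abs_apply a v).ge
  obtain ⟨w, hw, hwa⟩ := exists_contraction_mul_eq (A := CFC.abs a) (B := a)
    fun v => (norm_abs_apply a v).le
  refine ⟨w, c†, hw, by simpa using hc, ?_⟩
  have h1 : (CFC.abs a : H →L[ℂ] H)† = CFC.abs a := (abs_isPositive a).isSelfAdjoint.adjoint_eq
  rw [hwa, ← h1, ← ContinuousLinearMap.star_eq_adjoint, ← ContinuousLinearMap.star_eq_adjoint,
    ← ContinuousLinearMap.star_eq_adjoint, ← star_mul, hca]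

end SingularValues

/-! ### Singular systems and the triangle inequality in `C_p`. -/

section Schatten

/-- Jensen's inequality for `t ↦ t^p`. Total mass at most 1 suffices because `1 - 1/p ≥ 0`. -/
theorem ENNReal.tsum_mul_rpow_le {ι : Type*} {p : ℝ} (hp : 1 ≤ p) {w : ι → ℝ≥0∞}
    (hw : ∑' i, w i ≤ 1) (f : ι → ℝ≥0∞) : (∑' i, w i * f i) ^ p ≤ ∑' i, w i * f i ^ p := by
  have hp0 : 0 < p := zero_lt_one.trans_le hp
  have h : ∑' i, w i * f i ≤ (∑' i, w i * f i ^ p) ^ p⁻¹ := by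
    rw [ENNReal.tsum_eq_iSup_sum]
    refine iSup_le fun s => (ENNReal.inner_le_weight_mul_Lp_of_nonneg s hp w f).trans ?_
    have h1 : (∑ i ∈ s, w i) ^ (1 - p⁻¹) ≤ 1 :=
      ENNReal.rpow_le_one ((ENNReal.sum_le_tsum s).trans hw) (by
        rw [sub_nonneg]; exact inv_le_one_of_one_le₀ hp)
    refine (mul_le_mul' h1 (ENNReal.rpow_le_rpow (ENNReal.sum_le_tsum s)
      (inv_nonneg.2 hp0.le))).trans ?_
    rw [one_mul]
  refine (ENNReal.rpow_le_rpow h hp0.le).trans ?_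
  rw [ENNReal.rpow_inv_rpow hp0.ne']

theorem ENNReal.Lp_tsum_add_le {ι : Type*} {p : ℝ} (hp : 1 ≤ p) (f g : ι → ℝ≥0∞) :
    (∑' i, (f i + g i) ^ p) ^ (1 / p) ≤ (∑' i, f i ^ p) ^ (1 / p) + (∑' i, g i ^ p) ^ (1 / p) := by
  have hp0 : 0 < p := zero_lt_one.trans_le hp
  have h : ∑' i, (f i + g i) ^ p ≤
      ((∑' i, f i ^ p) ^ (1 / p) + (∑' i, g i ^ p) ^ (1 / p)) ^ p := by
    rw [ENNReal.tsum_eq_iSup_sum]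
    refine iSup_le fun s => ?_
    have h1 := ENNReal.Lp_add_le s f g hp
    have h2 := h1.trans (add_le_add
      (ENNReal.rpow_le_rpow (ENNReal.sum_le_tsum (f := fun i => f i ^ p) s)
        (one_div_nonneg.2 hp0.le))
      (ENNReal.rpow_le_rpow (ENNReal.sum_le_tsum (f := fun i => g i ^ p) s)
        (one_div_nonneg.2 hp0.le)))
    have h3 := ENNReal.rpow_le_rpow h2 hp0.le
    rwa [← ENNReal.rpow_mul, one_div_mul_cancel hp0.ne', ENNReal.rpow_one] at h3
  have h4 := ENNReal.rpow_le_rpow h (one_div_nonneg.2 hp0.le)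
  rwa [← ENNReal.rpow_mul, mul_one_div_cancel hp0.ne', ENNReal.rpow_one] at h4

variable {H : Type u} [NormedAddCommGroup H] [InnerProductSpace ℂ H]

theorem Orthonormal.tsum_ofReal_inner_le {ι : Type*} {v : ι → H} (hv : Orthonormal ℂ v) (x : H) :
    ∑' i, ENNReal.ofReal (‖inner ℂ (v i) x‖ ^ 2) ≤ ENNReal.ofReal (‖x‖ ^ 2) := by
  rw [ENNReal.tsum_eq_iSup_sum]
  refine iSup_le fun s => ?_
  rw [← ENNReal.ofReal_sum_of_nonneg fun _ _ => by positivity]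
  exact ENNReal.ofReal_le_ofReal (hv.sum_inner_products_le x)

variable [CompleteSpace H]

/-- The singular value decomposition: keep the eigenvectors `φ_i` of `|x|` with `μ_i > 0` and put
`ψ_i = μ_i⁻¹ x φ_i`. The discarded vectors lie in the kernel of `x` and contribute nothing to either
sum. -/
theorem exists_singular_system {x : H →L[ℂ] H} (hx : IsCompactOperator x) :
    ∃ (κ : Type u) (φ ψ : κ → H) (μ : κ → ℝ), Orthonormal ℂ φ ∧ Orthonormal ℂ ψ ∧
      (∀ i, 0 < μ i) ∧ (∀ i, x (φ i) = (μ i : ℂ) • ψ i) ∧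
      (∀ v, HasSum (fun i => inner ℂ (φ i) v • (μ i : ℂ) • ψ i) (x v)) ∧
      ∀ p : ℝ, 0 < p →
        ∑' n, ENNReal.ofReal (singularValue x n ^ p) = ∑' i, ENNReal.ofReal (μ i ^ p) := by
  obtain ⟨ι, b, μ, h0, hb⟩ := exists_hilbertBasis_abs hx
  have hne : ∀ i : {i // 0 < μ i}, (μ i : ℂ) ≠ 0 := fun i => by exact_mod_cast i.2.ne'
  have hxφ : ∀ i : {i // 0 < μ i}, x (b i) = (μ i : ℂ) • ((μ i : ℂ)⁻¹ • x (b i)) := fun i => by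
    rw [smul_smul, mul_inv_cancel₀ (hne i), one_smul]
  refine ⟨{i // 0 < μ i}, fun i => b i, fun i => (μ i : ℂ)⁻¹ • x (b i), fun i => μ i,
    b.orthonormal.comp _ Subtype.val_injective, ?_, fun i => i.2, hxφ, fun v => ?_, fun p hp => ?_⟩
  · classical
    rw [orthonormal_iff_ite]
    intro i j
    have h1 : inner ℂ (x (b i)) (x (b j)) = (μ j : ℂ) * (μ j : ℂ) * inner ℂ (b i) (b j) := by
      rw [← ContinuousLinearMap.adjoint_inner_right, ← abs_abs_apply, hb, map_smul, hb, smul_smul,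
        inner_smul_right]
    rw [inner_smul_left, inner_smul_right, h1, map_inv₀, Complex.conj_ofReal,
      orthonormal_iff_ite.1 b.orthonormal]
    by_cases hij : i = j
    · subst hij
      have := hne i
      simp only [if_true]
      field_simp
    · rw [if_neg (fun h => hij (Subtype.ext h)), if_neg hij]
      simp
  · have h1 := (b.hasSum_repr v).mapL x
    have hz : ∀ i, ¬ 0 < μ i → x (b i) = 0 := by
      intro i hi
      rw [← norm_le_zero_iff, ← norm_abs_apply, hb, le_antisymm (not_lt.1 hi) (h0 i)]
      simp
    have h2 : Function.support (fun i => x (b.repr v i • b i)) ⊆ {i | 0 < μ i} := by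
      intro i hi
      by_contra hn
      exact hi (by simp only [map_smul]; rw [hz i hn, smul_zero])
    have h3 := (hasSum_subtype_iff_of_support_subset h2).2 h1
    refine h3.congr_fun ?_
    intro i
    simp only [Function.comp_apply, map_smul]
    rw [← hxφ i, b.repr_apply_apply]
  · rw [tsum_singularValue_rpow h0 hb hp]
    refine (tsum_subtype_eq_of_support_subset (s := {i | 0 < μ i}) ?_).symm
    intro i hi
    by_contra hn
    have : μ i = 0 := le_antisymm (not_lt.1 hn) (h0 i)
    exact hi (by simp [this, Real.zero_rpow hp.ne'])

/-- For a compact operator `x` and orthonormal families `e`, `f`, the matrix entries `⟪f a, x (e a)⟫`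
are dominated by the singular values of `x` in the `l_p` sense. -/
theorem tsum_inner_rpow_le {x : H →L[ℂ] H} (hx : IsCompactOperator x) {p : ℝ} (hp : 1 ≤ p)
    {α : Type*} {e f : α → H} (he : Orthonormal ℂ e) (hf : Orthonormal ℂ f) :
    ∑' a, ENNReal.ofReal ‖inner ℂ (f a) (x (e a))‖ ^ p ≤
      ∑' n, ENNReal.ofReal (singularValue x n ^ p) := by
  obtain ⟨κ, φ, ψ, μ, hφ, hψ, hμ, -, hsum, htsum⟩ := exists_singular_system hx
  have hp0 : 0 < p := zero_lt_one.trans_le hp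
  rw [htsum p hp0]
  let A : α → κ → ℝ≥0∞ := fun a i => ENNReal.ofReal (‖inner ℂ (φ i) (e a)‖ ^ 2)
  let B : α → κ → ℝ≥0∞ := fun a i => ENNReal.ofReal (‖inner ℂ (ψ i) (f a)‖ ^ 2)
  -- By Bessel's inequality this matrix is doubly substochastic, and by the arithmetic-geometric
  -- mean inequality it dominates `‖⟪φ i, e a⟫‖ ‖⟪ψ i, f a⟫‖`. Row sums enter Jensen's inequality,
  -- and column sums are used after interchanging the summations.
  let D : α → κ → ℝ≥0∞ := fun a i => 2⁻¹ * (A a i + B a i)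
  have hA1 : ∀ a, ∑' i, A a i ≤ 1 := fun a => by
    have h := hφ.tsum_ofReal_inner_le (e a)
    rwa [he.1 a, one_pow, ENNReal.ofReal_one] at h
  have hB1 : ∀ a, ∑' i, B a i ≤ 1 := fun a => by
    have h := hψ.tsum_ofReal_inner_le (f a)
    rwa [hf.1 a, one_pow, ENNReal.ofReal_one] at h
  have hA2 : ∀ i, ∑' a, A a i ≤ 1 := fun i => by
    have h := he.tsum_ofReal_inner_le (φ i)
    simp only [A, norm_inner_symm (φ i)]
    rwa [hφ.1 i, one_pow, ENNReal.ofReal_one] at h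
  have hB2 : ∀ i, ∑' a, B a i ≤ 1 := fun i => by
    have h := hf.tsum_ofReal_inner_le (ψ i)
    simp only [B, norm_inner_symm (ψ i)]
    rwa [hψ.1 i, one_pow, ENNReal.ofReal_one] at h
  have half : (2⁻¹ : ℝ≥0∞) * (1 + 1) = 1 := by
    rw [one_add_one_eq_two]; exact ENNReal.inv_mul_cancel (by simp) (by simp)
  have hD1 : ∀ a, ∑' i, D a i ≤ 1 := fun a => by
    rw [ENNReal.tsum_mul_left, ENNReal.tsum_add, ← half]
    exact mul_le_mul_right (add_le_add (hA1 a) (hB1 a)) _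
  have hD2 : ∀ i, ∑' a, D a i ≤ 1 := fun i => by
    rw [ENNReal.tsum_mul_left, ENNReal.tsum_add, ← half]
    exact mul_le_mul_right (add_le_add (hA2 i) (hB2 i)) _
  have hterm : ∀ a i, ‖inner ℂ (f a) (inner ℂ (φ i) (e a) • (μ i : ℂ) • ψ i)‖ₑ ≤
      D a i * ENNReal.ofReal (μ i) := by
    intro a i
    have hD : D a i = ENNReal.ofReal
        ((‖inner ℂ (φ i) (e a)‖ ^ 2 + ‖inner ℂ (ψ i) (f a)‖ ^ 2) / 2) := by
      simp only [D, A, B]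
      rw [← ENNReal.ofReal_add (by positivity) (by positivity), div_eq_inv_mul,
        ENNReal.ofReal_mul (by norm_num), ENNReal.ofReal_inv_of_pos (by norm_num),
        ENNReal.ofReal_ofNat]
    rw [hD, ← ENNReal.ofReal_mul (by positivity), ← ofReal_norm]
    refine ENNReal.ofReal_le_ofReal ?_
    rw [inner_smul_right, inner_smul_right, norm_mul, norm_mul, Complex.norm_real,
      Real.norm_of_nonneg (hμ i).le, norm_inner_symm (f a)]
    nlinarith [mul_nonneg (hμ i).le
      (sq_nonneg (‖inner ℂ (φ i) (e a)‖ - ‖inner ℂ (ψ i) (f a)‖))]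
  have hle : ∀ a, ENNReal.ofReal ‖inner ℂ (f a) (x (e a))‖ ≤
      ∑' i, D a i * ENNReal.ofReal (μ i) := by
    intro a
    have h1 := ((hsum (e a)).mapL (innerSL ℂ (f a)))
    have h2 := (continuous_enorm.tendsto _).comp h1
    rw [ofReal_norm]
    refine le_of_tendsto h2 (.of_forall fun s => ?_)
    refine (enorm_sum_le s _).trans ((Finset.sum_le_sum fun i _ => ?_).trans
      (ENNReal.sum_le_tsum s))
    exact hterm a i
  calc ∑' a, ENNReal.ofReal ‖inner ℂ (f a) (x (e a))‖ ^ p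
      ≤ ∑' a, ∑' i, D a i * ENNReal.ofReal (μ i) ^ p :=
        ENNReal.tsum_le_tsum fun a => (ENNReal.rpow_le_rpow (hle a) hp0.le).trans
          (ENNReal.tsum_mul_rpow_le hp (hD1 a) _)
    _ = ∑' i, (∑' a, D a i) * ENNReal.ofReal (μ i) ^ p := by
        rw [ENNReal.tsum_comm]
        exact tsum_congr fun i => ENNReal.tsum_mul_right
    _ ≤ ∑' i, 1 * ENNReal.ofReal (μ i) ^ p :=
        ENNReal.tsum_le_tsum fun i => mul_le_mul_left (hD2 i) _
    _ = ∑' i, ENNReal.ofReal (μ i ^ p) :=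
        tsum_congr fun i => by rw [one_mul, ENNReal.ofReal_rpow_of_pos (hμ i)]

theorem opNorm_lpNorm (p : ℝ) (x : H →L[ℂ] H) :
    opNorm (lpNorm p) x = (∑' n, ENNReal.ofReal (singularValue x n ^ p)) ^ (1 / p) := by
  simp only [opNorm, lpNorm, abs_of_nonneg (singularValue_nonneg x _)]

/-- In the singular system of `x - y` one has `μ_i = ⟪ψ_i, x φ_i⟫ - ⟪ψ_i, y φ_i⟫`. Minkowski's
inequality splits the sum, and `tsum_inner_rpow_le` bounds each part. -/
theorem opNorm_lpNorm_sub_le {x y : H →L[ℂ] H} (hx : IsCompactOperator x)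
    (hy : IsCompactOperator y) {p : ℝ} (hp : 1 ≤ p) :
    opNorm (lpNorm p) (x - y) ≤ opNorm (lpNorm p) x + opNorm (lpNorm p) y := by
  obtain ⟨κ, φ, ψ, μ, hφ, hψ, hμ, hφψ, -, htsum⟩ := exists_singular_system (x := x - y) (hx.sub hy)
  have hp0 : 0 < p := zero_lt_one.trans_le hp
  have h1p := one_div_nonneg.2 hp0.le
  simp only [opNorm_lpNorm]
  have h : ∀ i, ENNReal.ofReal (μ i ^ p) ≤ (ENNReal.ofReal ‖inner ℂ (ψ i) (x (φ i))‖ +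
      ENNReal.ofReal ‖inner ℂ (ψ i) (y (φ i))‖) ^ p := by
    intro i
    rw [← ENNReal.ofReal_rpow_of_pos (hμ i)]
    refine ENNReal.rpow_le_rpow ?_ hp0.le
    rw [← ENNReal.ofReal_add (norm_nonneg _) (norm_nonneg _)]
    refine ENNReal.ofReal_le_ofReal ?_
    have h1 : inner ℂ (ψ i) (x (φ i)) - inner ℂ (ψ i) (y (φ i)) = (μ i : ℂ) := by
      rw [← inner_sub_right]
      have := hφψ i
      rw [sub_apply] at this
      rw [this, inner_smul_right, inner_self_eq_norm_sq_to_K, hψ.1 i]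
      simp
    have h2 := norm_sub_le (inner ℂ (ψ i) (x (φ i))) (inner ℂ (ψ i) (y (φ i)))
    rwa [h1, Complex.norm_real, Real.norm_of_nonneg (hμ i).le] at h2
  have hs := htsum p hp0
  rw [show (∑' n, ENNReal.ofReal (singularValue (x - y) n ^ p)) = _ from hs]
  refine (ENNReal.rpow_le_rpow (ENNReal.tsum_le_tsum h) h1p).trans ?_
  refine (ENNReal.Lp_tsum_add_le hp _ _).trans ?_
  exact add_le_add (ENNReal.rpow_le_rpow (tsum_inner_rpow_le hx hp hφ hψ) h1p)
    (ENNReal.rpow_le_rpow (tsum_inner_rpow_le hy hp hφ hψ) h1p)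

end Schatten

/-! ### Multipliers from `C_{l^p_ω}` to `C_p` and the norm estimates. -/

section Ideals

/-- Abel summation as an induction. Keeping the factor `g k` on the left closes the induction, and
for `g ≥ 0` the right-hand side is seen to be nonnegative. -/
theorem sum_mul_le_of_sum_le {c g : ℕ → ℝ} (hg : Antitone g)
    (hc : ∀ k, 0 ≤ ∑ n ∈ Finset.range k, c n) (k : ℕ) :
    (∑ n ∈ Finset.range k, c n) * g k ≤ ∑ n ∈ Finset.range k, c n * g n := by
  induction k with
  | zero => simp
  | succ k ih =>
    calc (∑ n ∈ Finset.range (k + 1), c n) * g (k + 1)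
        ≤ (∑ n ∈ Finset.range (k + 1), c n) * g k :=
          mul_le_mul_of_nonneg_left (hg k.le_succ) (hc _)
      _ = (∑ n ∈ Finset.range k, c n) * g k + c k * g k := by
          rw [Finset.sum_range_succ, add_mul]
      _ ≤ _ := by rw [Finset.sum_range_succ]; gcongr

theorem tsum_mul_le_of_sum_le {t ω g : ℕ → ℝ} {M : ℝ} (ht : 0 ≤ t) (hg : Antitone g) (hg0 : 0 ≤ g)
    (hω : 0 ≤ ω) (hM : 0 ≤ M)
    (h : ∀ k, ∑ n ∈ Finset.range k, t n ≤ M * ∑ n ∈ Finset.range k, ω n) :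
    ∑' n, ENNReal.ofReal (t n * g n) ≤
      ENNReal.ofReal M * ∑' n, ENNReal.ofReal (g n * ω n) := by
  refine ENNReal.tsum_le_of_sum_range_le fun k => ?_
  -- Abel summation is applied to `c = M ω - t`, whose partial sums are nonnegative by hypothesis.
  have h1 : ∀ k, 0 ≤ ∑ n ∈ Finset.range k, (M * ω n - t n) := by
    intro k
    rw [Finset.sum_sub_distrib, ← Finset.mul_sum, sub_nonneg]
    exact h k
  have h2 := (mul_nonneg (h1 k) (hg0 k)).trans (sum_mul_le_of_sum_le hg h1 k)
  simp only [sub_mul, Finset.sum_sub_distrib, sub_nonneg] at h2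
  calc ∑ n ∈ Finset.range k, ENNReal.ofReal (t n * g n)
      = ENNReal.ofReal (∑ n ∈ Finset.range k, t n * g n) :=
        (ENNReal.ofReal_sum_of_nonneg fun n _ => mul_nonneg (ht n) (hg0 n)).symm
    _ ≤ ENNReal.ofReal (M * ∑ n ∈ Finset.range k, g n * ω n) := by
        refine ENNReal.ofReal_le_ofReal (h2.trans_eq ?_)
        rw [Finset.mul_sum]
        exact Finset.sum_congr rfl fun n _ => by ring
    _ = ENNReal.ofReal M * ∑ n ∈ Finset.range k, ENNReal.ofReal (g n * ω n) := by
        rw [ENNReal.ofReal_mul hM,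
          ENNReal.ofReal_sum_of_nonneg fun n _ => mul_nonneg (hg0 n) (hω n)]
    _ ≤ _ := by gcongr; exact ENNReal.sum_le_tsum _

variable {H : Type u} [NormedAddCommGroup H] [InnerProductSpace ℂ H]

theorem isDerivation_of_eq_commutator {I J : NonUnitalSubalgebra ℂ (H →L[ℂ] H)} {δ : I →ₗ[ℂ] J}
    {a : H →L[ℂ] H} (hδ : ∀ x, (δ x : H →L[ℂ] H) = a * x - x * a) : IsDerivation δ := by
  intro x y
  simp only [hδ]
  change a * ((x : H →L[ℂ] H) * y) - (x : H →L[ℂ] H) * y * a = _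
  noncomm_ring

variable [CompleteSpace H]

local postfix:max "†" => ContinuousLinearMap.adjoint

theorem opNorm_lorentzNorm (p : ℝ) (ω : ℕ → ℝ) (x : H →L[ℂ] H) :
    opNorm (lorentzNorm p ω) x =
      (∑' n, ENNReal.ofReal (singularValue x n ^ p * ω n)) ^ (1 / p) := by
  rw [opNorm, lorentzNorm, rearr_eq_self (singularValue_antitone x) (singularValue_nonneg x)]

theorem opNorm_marcinkiewiczNorm (p : ℝ) (ω : ℕ → ℝ) (x : H →L[ℂ] H) :
    opNorm (marcinkiewiczNorm p ω) x = ⨆ k : ℕ, ENNReal.ofReal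
      (((∑ n ∈ Finset.range (k + 1), singularValue x n ^ p) /
        ∑ n ∈ Finset.range (k + 1), ω n) ^ (1 / p)) := by
  rw [opNorm, marcinkiewiczNorm, rearr_eq_self (singularValue_antitone x) (singularValue_nonneg x)]

theorem opNorm_lpNorm_mono {p : ℝ} (hp : 1 ≤ p) {x y : H →L[ℂ] H}
    (h : ∀ n, singularValue x n ≤ singularValue y n) :
    opNorm (lpNorm p) x ≤ opNorm (lpNorm p) y := by
  have hp0 : 0 ≤ p := zero_le_one.trans hp
  simp only [opNorm_lpNorm]
  refine ENNReal.rpow_le_rpow (ENNReal.tsum_le_tsum fun n => ENNReal.ofReal_le_ofReal ?_)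
    (one_div_nonneg.2 hp0)
  exact Real.rpow_le_rpow (singularValue_nonneg x n) (h n) hp0

theorem opNorm_lorentzNorm_mono {p : ℝ} (hp : 1 ≤ p) {ω : ℕ → ℝ} (hω : IsWeight ω)
    {x y : H →L[ℂ] H} (h : ∀ n, singularValue x n ≤ singularValue y n) :
    opNorm (lorentzNorm p ω) x ≤ opNorm (lorentzNorm p ω) y := by
  have hp0 : 0 ≤ p := zero_le_one.trans hp
  simp only [opNorm_lorentzNorm]
  refine ENNReal.rpow_le_rpow (ENNReal.tsum_le_tsum fun n => ENNReal.ofReal_le_ofReal ?_)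
    (one_div_nonneg.2 hp0)
  exact mul_le_mul_of_nonneg_right (Real.rpow_le_rpow (singularValue_nonneg x n) (h n) hp0)
    (hω.pos n).le

theorem adjoint_mem_opClass {N : (ℕ → ℝ) → ℝ≥0∞} {x : H →L[ℂ] H}
    (hx : x ∈ opClass H (seqSpace N)) : x† ∈ opClass H (seqSpace N) := by
  refine ⟨hx.1.adjoint_of_tendsto hx.2.1, ?_⟩
  rw [singularValue_adjoint hx.1 hx.2.1]
  exact hx.2

theorem sum_singularValue_rpow_le {p : ℝ} (hp : 1 ≤ p) {ω : ℕ → ℝ} (hω : IsWeight ω)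
    {a : H →L[ℂ] H} (ha : opNorm (marcinkiewiczNorm p ω) a < ∞) (k : ℕ) :
    ∑ n ∈ Finset.range k, singularValue a n ^ p ≤
      (opNorm (marcinkiewiczNorm p ω) a).toReal ^ p * ∑ n ∈ Finset.range k, ω n := by
  have hp0 : 0 < p := zero_lt_one.trans_le hp
  rcases k with _ | k
  · simp
  have hW : 0 < ∑ n ∈ Finset.range (k + 1), ω n :=
    Finset.sum_pos (fun n _ => hω.pos n) ⟨0, by simp⟩
  have hS : 0 ≤ ∑ n ∈ Finset.range (k + 1), singularValue a n ^ p :=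
    Finset.sum_nonneg fun n _ => Real.rpow_nonneg (singularValue_nonneg a n) p
  have h1 : ENNReal.ofReal (((∑ n ∈ Finset.range (k + 1), singularValue a n ^ p) /
      ∑ n ∈ Finset.range (k + 1), ω n) ^ (1 / p)) ≤ opNorm (marcinkiewiczNorm p ω) a := by
    rw [opNorm_marcinkiewiczNorm]
    exact le_iSup (fun k : ℕ => ENNReal.ofReal
      (((∑ n ∈ Finset.range (k + 1), singularValue a n ^ p) /
        ∑ n ∈ Finset.range (k + 1), ω n) ^ (1 / p))) k
  have h2 := (ENNReal.ofReal_le_iff_le_toReal ha.ne).1 h1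
  have h3 := Real.rpow_le_rpow (by positivity) h2 hp0.le
  rw [← Real.rpow_mul (by positivity), one_div_mul_cancel hp0.ne', Real.rpow_one,
    div_le_iff₀ hW] at h3
  exact h3

/-- The constant is really `2^(1/p)`: the inequality `s_n(ax) ≤ s_{n/2}(a) s_{n/2}(x)` counts each
product twice. -/
theorem opNorm_mul_le {p : ℝ} (hp : 1 ≤ p) {ω : ℕ → ℝ} (hω : IsWeight ω) {a x : H →L[ℂ] H}
    (hac : IsCompactOperator a) (ha : opNorm (marcinkiewiczNorm p ω) a < ∞)
    (hx : IsCompactOperator x) :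
    opNorm (lpNorm p) (a * x) ≤
      2 * opNorm (marcinkiewiczNorm p ω) a * opNorm (lorentzNorm p ω) x := by
  have hp0 : 0 < p := zero_lt_one.trans_le hp
  have h1p := one_div_nonneg.2 hp0.le
  set M := opNorm (marcinkiewiczNorm p ω) a with hM
  have h1 : ∀ n, ENNReal.ofReal (singularValue (a * x) n ^ p) ≤
      (fun m => ENNReal.ofReal (singularValue a m ^ p * singularValue x m ^ p)) (n / 2) := by
    intro n
    refine ENNReal.ofReal_le_ofReal ?_
    rw [← Real.mul_rpow (singularValue_nonneg _ _) (singularValue_nonneg _ _)]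
    refine Real.rpow_le_rpow (singularValue_nonneg _ _) ?_ hp0.le
    exact (singularValue_antitone _ (by omega)).trans
      (singularValue_mul_le_mul hac hx (n / 2) (n / 2))
  have h2 : ∑' n, ENNReal.ofReal (singularValue (a * x) n ^ p) ≤
      2 * (M ^ p * ∑' n, ENNReal.ofReal (singularValue x n ^ p * ω n)) := by
    refine (ENNReal.tsum_le_tsum h1).trans ?_
    rw [tsum_half fun m => ENNReal.ofReal (singularValue a m ^ p * singularValue x m ^ p)]
    refine mul_le_mul_right ?_ _
    have h3 := tsum_mul_le_of_sum_le (t := fun n => singularValue a n ^ p)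
      (g := fun n => singularValue x n ^ p) (ω := ω)
      (M := M.toReal ^ p) (fun n => Real.rpow_nonneg (singularValue_nonneg a n) p)
      (fun m n hmn => Real.rpow_le_rpow (singularValue_nonneg x n)
        (singularValue_antitone x hmn) hp0.le)
      (fun n => Real.rpow_nonneg (singularValue_nonneg x n) p) (fun n => (hω.pos n).le)
      (by positivity) (sum_singularValue_rpow_le hp hω ha)
    refine h3.trans_eq ?_
    rw [← ENNReal.ofReal_rpow_of_nonneg ENNReal.toReal_nonneg hp0.le, ENNReal.ofReal_toReal ha.ne]
  rw [opNorm_lpNorm, opNorm_lorentzNorm]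
  refine (ENNReal.rpow_le_rpow h2 h1p).trans ?_
  rw [ENNReal.mul_rpow_of_nonneg _ _ h1p, ENNReal.mul_rpow_of_nonneg _ _ h1p, ← ENNReal.rpow_mul,
    mul_one_div_cancel hp0.ne', ENNReal.rpow_one, ← mul_assoc]
  refine mul_le_mul_left (mul_le_mul_left ?_ _) _
  calc (2 : ℝ≥0∞) ^ (1 / p) ≤ 2 ^ (1 : ℝ) :=
        ENNReal.rpow_le_rpow_of_exponent_le (by norm_num) ((div_le_one hp0).2 hp)
    _ = 2 := ENNReal.rpow_one 2

variable {p : ℝ} (hp : 1 ≤ p) {ω : ℕ → ℝ} (hω : IsWeight ω)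

theorem mul_mem_schattenIdeal {a x : H →L[ℂ] H}
    (ha : a ∈ opClass H (seqSpace (marcinkiewiczNorm p ω))) (hx : x ∈ lorentzIdeal H hp hω) :
    a * x ∈ schattenIdeal H hp := by
  have h1 := mul_mem_opClass (admissible_lorentz hp hω) a hx
  refine ⟨h1.1, h1.2.1, (opNorm_mul_le hp hω ha.1 ha.2.2 hx.1).trans_lt ?_⟩
  exact ENNReal.mul_lt_top (ENNReal.mul_lt_top (by simp) ha.2.2) hx.2.2

theorem adjoint_mem_lorentzIdeal {x : H →L[ℂ] H} (hx : x ∈ lorentzIdeal H hp hω) :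
    x† ∈ lorentzIdeal H hp hω :=
  adjoint_mem_opClass hx

theorem mul_eq_adjoint (x a : H →L[ℂ] H) : x * a = (a† * x†)† := by
  simp only [← ContinuousLinearMap.star_eq_adjoint, star_mul, star_star]

theorem mul_mem_schattenIdeal' {a x : H →L[ℂ] H}
    (ha : a ∈ opClass H (seqSpace (marcinkiewiczNorm p ω))) (hx : x ∈ lorentzIdeal H hp hω) :
    x * a ∈ schattenIdeal H hp := by
  rw [mul_eq_adjoint]
  exact adjoint_mem_opClass
    (mul_mem_schattenIdeal hp hω (adjoint_mem_opClass ha) (adjoint_mem_lorentzIdeal hp hω hx))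

theorem opNorm_mul_le_dualNorm {a x : H →L[ℂ] H} (hx : x ∈ lorentzIdeal H hp hω)
    (h1 : opNorm (lorentzNorm p ω) x ≤ 1) :
    opNorm (lpNorm p) (a * x) ≤
      dualNorm (lpNorm p) (lorentzNorm p ω) (lorentzIdeal H hp hω) a :=
  le_iSup₂ (f := fun (x : lorentzIdeal H hp hω) (_ : opNorm (lorentzNorm p ω) (x : H →L[ℂ] H) ≤ 1)
    => opNorm (lpNorm p) (a * (x : H →L[ℂ] H))) ⟨x, hx⟩ h1

/-- Here `xa` has the singular values of `a† x† = w a (u x†)` with contractions `w` and `u`, and `u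
x†` is again in the unit ball of the Lorentz ideal. -/
theorem opNorm_mul_le_dualNorm' {a x : H →L[ℂ] H} (hx : x ∈ lorentzIdeal H hp hω)
    (h1 : opNorm (lorentzNorm p ω) x ≤ 1) :
    opNorm (lpNorm p) (x * a) ≤
      dualNorm (lpNorm p) (lorentzNorm p ω) (lorentzIdeal H hp hω) a := by
  obtain ⟨w, u, hw, hu, hau⟩ := exists_adjoint_eq_mul_mul a
  have hx' := adjoint_mem_lorentzIdeal hp hω hx
  have hy : u * x† ∈ lorentzIdeal H hp hω := mul_mem_opClass (admissible_lorentz hp hω) u hx'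
  have hay : a * (u * x†) ∈ lorentzIdeal H hp hω :=
    mul_mem_opClass (admissible_lorentz hp hω) a hy
  have hz : a† * x† ∈ lorentzIdeal H hp hω := mul_mem_opClass (admissible_lorentz hp hω) _ hx'
  refine le_trans (opNorm_lpNorm_mono hp fun n => ?_) (opNorm_mul_le_dualNorm hp hω hy ?_)
  · rw [mul_eq_adjoint, singularValue_adjoint hz.1 hz.2.1, hau, mul_assoc, mul_assoc]
    exact singularValue_mul_le_of_norm_le_one hw hay.1 n
  · refine le_trans (opNorm_lorentzNorm_mono hp hω fun n => ?_) h1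
    refine (singularValue_mul_le_of_norm_le_one hu hx'.1 n).trans_eq ?_
    rw [singularValue_adjoint hx.1 hx.2.1]

theorem mapNorm_le_dualNorm {a : H →L[ℂ] H}
    (ha : a ∈ opClass H (seqSpace (marcinkiewiczNorm p ω)))
    {δ : lorentzIdeal H hp hω →ₗ[ℂ] schattenIdeal H hp}
    (hδ : ∀ x, (δ x : H →L[ℂ] H) = a * x - x * a) :
    mapNorm (lpNorm p) (lorentzNorm p ω) δ ≤
      2 * dualNorm (lpNorm p) (lorentzNorm p ω) (lorentzIdeal H hp hω) a := by
  refine iSup₂_le fun x hx => ?_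
  rw [hδ, two_mul]
  exact (opNorm_lpNorm_sub_le (mul_mem_schattenIdeal hp hω ha x.2).1
    (mul_mem_schattenIdeal' hp hω ha x.2).1 hp).trans
    (add_le_add (opNorm_mul_le_dualNorm hp hω x.2 hx) (opNorm_mul_le_dualNorm' hp hω x.2 hx))

theorem dualNorm_le {a : H →L[ℂ] H} (ha : a ∈ opClass H (seqSpace (marcinkiewiczNorm p ω))) :
    dualNorm (lpNorm p) (lorentzNorm p ω) (lorentzIdeal H hp hω) a ≤
      2 * opNorm (marcinkiewiczNorm p ω) a := by
  refine iSup₂_le fun x hx => (opNorm_mul_le hp hω ha.1 ha.2.2 x.2.1).trans ?_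
  exact mul_le_of_le_one_right' hx

theorem exists_inner_linearMap {a : H →L[ℂ] H}
    (ha : a ∈ opClass H (seqSpace (marcinkiewiczNorm p ω))) :
    ∃ δ : lorentzIdeal H hp hω →ₗ[ℂ] schattenIdeal H hp,
      ∀ x, (δ x : H →L[ℂ] H) = a * x - x * a :=
  ⟨{  toFun := fun x => ⟨a * x - x * a, sub_mem (mul_mem_schattenIdeal hp hω ha x.2)
        (mul_mem_schattenIdeal' hp hω ha x.2)⟩
      map_add' := fun x y => Subtype.ext (by
        change a * (x + y : H →L[ℂ] H) - (x + y : H →L[ℂ] H) * a =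
          (a * x - x * a) + (a * y - y * a)
        noncomm_ring)
      map_smul' := fun c x => Subtype.ext (by
        change a * (c • (x : H →L[ℂ] H)) - (c • (x : H →L[ℂ] H)) * a = c • (a * x - x * a)
        rw [mul_smul_comm, smul_mul_assoc, smul_sub]) }, fun _ => rfl⟩

end Ideals

/-! ### Multipliers of sequences and decay of monotone sequences. -/

section SequenceSpaces

/-- A condensation of singularities. If the bound fails with constant `4^j` at `k j` for every `j`,
then a weighted sum `η` of the indicators of `[0, k j)` is decreasing with `∑ η ω = ∑ 2^(-j) < ∞`,
while `∑ t η ≥ 2^(-j) 4^j = 2^j` for every `j`. -/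
theorem exists_sum_le_of_forall_tsum_lt_top {t ω : ℕ → ℝ} (ht : 0 ≤ t) (hω : IsWeight ω)
    (h : ∀ η : ℕ → ℝ, Antitone η → 0 ≤ η → ∑' n, ENNReal.ofReal (η n * ω n) < ∞ →
      ∑' n, ENNReal.ofReal (t n * η n) < ∞) :
    ∃ M, 0 ≤ M ∧ ∀ k, ∑ n ∈ Finset.range k, t n ≤ M * ∑ n ∈ Finset.range k, ω n := by
  by_contra hcon
  push Not at hcon
  choose k hk using fun j : ℕ => hcon ((4 : ℝ) ^ j) (by positivity)
  have hk0 : ∀ j, 0 < k j := by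
    intro j
    rcases Nat.eq_zero_or_pos (k j) with h0 | h0
    · have := hk j
      rw [h0] at this
      simp at this
    · exact h0
  set W : ℕ → ℝ := fun k => ∑ n ∈ Finset.range k, ω n with hW
  have hWle : ∀ j, ω 0 ≤ W (k j) := fun j =>
    Finset.single_le_sum (f := ω) (fun n _ => (hω.pos n).le) (Finset.mem_range.2 (hk0 j))
  have hWpos : ∀ j, 0 < W (k j) := fun j => (hω.pos 0).trans_le (hWle j)
  -- Normalised so that the `j`-th step function has weighted sum exactly `2^(-j)`.
  let c : ℕ → ℝ := fun j => (1 / 2) ^ j / W (k j)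
  have hc0 : ∀ j, 0 < c j := fun j => div_pos (by positivity) (hWpos j)
  let u : ℕ → ℕ → ℝ := fun j n => if n < k j then c j else 0
  have hu0 : ∀ j n, 0 ≤ u j n := fun j n => by
    simp only [u]; split_ifs
    exacts [(hc0 j).le, le_rfl]
  have hule : ∀ j n, u j n ≤ (1 / 2) ^ j / ω 0 := fun j n => by
    have h1 : c j ≤ (1 / 2) ^ j / ω 0 :=
      div_le_div_of_nonneg_left (by positivity) (hω.pos 0) (hWle j)
    simp only [u]; split_ifs
    exacts [h1, (hc0 j).le.trans h1]
  have hgeo : Summable fun j : ℕ => ((1 : ℝ) / 2) ^ j :=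
    summable_geometric_of_lt_one (by norm_num) (by norm_num)
  have hus : ∀ n, Summable fun j => u j n := fun n =>
    Summable.of_nonneg_of_le (fun j => hu0 j n) (fun j => hule j n) (hgeo.div_const _)
  have huanti : ∀ j, Antitone (u j) := by
    intro j m n hmn
    simp only [u]
    split_ifs with h1 h2
    · exact le_rfl
    · omega
    · exact (hc0 j).le
    · exact le_rfl
  let η : ℕ → ℝ := fun n => ∑' j, u j n
  have hsum : ∑' n, ENNReal.ofReal (η n * ω n) < ∞ := by
    have h1 : ∀ n, ENNReal.ofReal (η n * ω n) = ∑' j, ENNReal.ofReal (u j n * ω n) := by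
      intro n
      rw [← ENNReal.ofReal_tsum_of_nonneg (fun j => mul_nonneg (hu0 j n) (hω.pos n).le)
        ((hus n).mul_right _), tsum_mul_right]
    have h2 : ∀ j, ∑' n, ENNReal.ofReal (u j n * ω n) = ENNReal.ofReal ((1 / 2) ^ j) := by
      intro j
      rw [tsum_eq_sum (s := Finset.range (k j)) (fun n hn => by
        simp only [u, if_neg (fun h => hn (Finset.mem_range.2 h)), zero_mul, ENNReal.ofReal_zero]),
        ← ENNReal.ofReal_sum_of_nonneg fun n _ => mul_nonneg (hu0 j n) (hω.pos n).le]
      congr 1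
      have h3 : ∑ n ∈ Finset.range (k j), u j n * ω n = c j * W (k j) := by
        rw [hW, Finset.mul_sum]
        exact Finset.sum_congr rfl fun n hn => by
          simp only [u, if_pos (Finset.mem_range.1 hn)]
      rw [h3]
      exact div_mul_cancel₀ _ (hWpos j).ne'
    simp only [h1]
    rw [ENNReal.tsum_comm]
    simp only [h2]
    rw [← ENNReal.ofReal_tsum_of_nonneg (fun j => by positivity) hgeo]
    exact ENNReal.ofReal_lt_top
  have hfin := h η (fun m n hmn => (hus n).tsum_le_tsum (fun j => huanti j hmn) (hus m))
    (fun n => tsum_nonneg fun j => hu0 j n) hsum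
  obtain ⟨j, hj⟩ := pow_unbounded_of_one_lt
    (∑' n, ENNReal.ofReal (t n * η n)).toReal (one_lt_two : (1 : ℝ) < 2)
  have h5 : ENNReal.ofReal (2 ^ j) ≤ ∑' n, ENNReal.ofReal (t n * η n) := by
    refine le_trans ?_ (ENNReal.sum_le_tsum (Finset.range (k j)))
    rw [← ENNReal.ofReal_sum_of_nonneg fun n _ =>
      mul_nonneg (ht n) (tsum_nonneg fun j => hu0 j n)]
    refine ENNReal.ofReal_le_ofReal ?_
    have h6 : c j * ∑ n ∈ Finset.range (k j), t n ≤ ∑ n ∈ Finset.range (k j), t n * η n := by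
      rw [Finset.mul_sum]
      refine Finset.sum_le_sum fun n hn => ?_
      rw [mul_comm]
      refine mul_le_mul_of_nonneg_left ?_ (ht n)
      have := (hus n).le_tsum j fun i _ => hu0 i n
      simpa only [u, if_pos (Finset.mem_range.1 hn)] using this
    refine le_trans ?_ h6
    have h7 : c j * (4 ^ j * W (k j)) ≤ c j * ∑ n ∈ Finset.range (k j), t n :=
      mul_le_mul_of_nonneg_left (hk j).le (hc0 j).le
    refine le_trans (le_of_eq ?_) h7
    have h8 := (hWpos j).ne'
    simp only [c]
    rw [div_mul_eq_mul_div, mul_comm (4 ^ j) _, ← mul_assoc, mul_right_comm, mul_div_assoc,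
      div_self h8, mul_one, ← mul_pow]
    norm_num
  have h6 := (ENNReal.ofReal_le_iff_le_toReal hfin.ne).1 h5
  linarith

/-- A positive limit `L` would force `L W_k` to stay below the sum, against the divergence of `W_k`.
-/
theorem tendsto_zero_of_antitone_of_tsum_lt_top {η ω : ℕ → ℝ} (hω : IsWeight ω) (hη : Antitone η)
    (h0 : 0 ≤ η) (h : ∑' n, ENNReal.ofReal (η n * ω n) < ∞) : Tendsto η atTop (𝓝 0) := by
  have hbdd : BddBelow (Set.range η) := ⟨0, by rintro _ ⟨n, rfl⟩; exact h0 n⟩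
  have hlim := tendsto_atTop_ciInf hη hbdd
  set L := ⨅ n, η n with hL
  have hL0 : 0 ≤ L := le_ciInf h0
  have hLle : ∀ n, L ≤ η n := fun n => ciInf_le hbdd n
  rcases hL0.eq_or_lt with h1 | h1
  · rwa [← h1] at hlim
  · exfalso
    set S := ∑' n, ENNReal.ofReal (η n * ω n) with hS
    obtain ⟨k, hk⟩ := (hω.tendsto_sum.eventually_gt_atTop (S.toReal / L)).exists
    have h2 : ENNReal.ofReal (L * ∑ n ∈ Finset.range k, ω n) ≤ S := by
      refine le_trans ?_ (ENNReal.sum_le_tsum (Finset.range k))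
      rw [← ENNReal.ofReal_sum_of_nonneg fun n _ => mul_nonneg (h0 n) (hω.pos n).le,
        Finset.mul_sum]
      exact ENNReal.ofReal_le_ofReal (Finset.sum_le_sum fun n _ =>
        mul_le_mul_of_nonneg_right (hLle n) (hω.pos n).le)
    have h3 := (ENNReal.ofReal_le_iff_le_toReal h.ne).1 h2
    rw [div_lt_iff₀ h1] at hk
    linarith

/-- By monotonicity `k d_k^p ≤ ∑_{n<k} d_n^p`, so `d_k^p` is at most `M` times a Cesàro mean of `ω`,
which tends to 0 with `ω`. -/
theorem tendsto_zero_of_sum_rpow_le {d ω : ℕ → ℝ} {p M : ℝ} (hp : 0 < p) (hd : Antitone d)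
    (h0 : 0 ≤ d) (hω : Tendsto ω atTop (𝓝 0))
    (h : ∀ k, ∑ n ∈ Finset.range k, d n ^ p ≤ M * ∑ n ∈ Finset.range k, ω n) :
    Tendsto d atTop (𝓝 0) := by
  have h1 : Tendsto (fun n => d n ^ p) atTop (𝓝 0) := by
    have h2 := hω.cesaro.const_mul M
    rw [mul_zero] at h2
    refine tendsto_of_tendsto_of_tendsto_of_le_of_le' tendsto_const_nhds h2
      (.of_forall fun n => Real.rpow_nonneg (h0 n) p) ?_
    filter_upwards [eventually_gt_atTop 0] with k hk
    have hk' : (0 : ℝ) < k := by exact_mod_cast hk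
    have h3 : (k : ℝ) * d k ^ p ≤ M * ∑ n ∈ Finset.range k, ω n := by
      refine le_trans ?_ (h k)
      have := Finset.card_nsmul_le_sum (Finset.range k) (fun n => d n ^ p) (d k ^ p)
        fun n hn => Real.rpow_le_rpow (h0 k) (hd (Finset.mem_range.1 hn).le) hp.le
      simpa using this
    rw [mul_left_comm]
    rwa [← div_eq_inv_mul, le_div_iff₀ hk', mul_comm]
  have h4 := h1.rpow_const (p := 1 / p) (Or.inr (one_div_nonneg.2 hp.le))
  rw [Real.zero_rpow (one_div_ne_zero hp.ne')] at h4
  refine h4.congr fun n => ?_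
  rw [← Real.rpow_mul (h0 n), mul_one_div_cancel hp.ne', Real.rpow_one]

theorem sum_div_le {g : ℕ → ℝ} (h0 : 0 ≤ g) {m : ℕ} (hm : 0 < m) (k : ℕ) :
    ∑ n ∈ Finset.range k, g (n / m) ≤ m * ∑ n ∈ Finset.range k, g n := by
  have h1 : ∑ n ∈ Finset.range (m * k), g (n / m) = m * ∑ n ∈ Finset.range k, g n := by
    induction k with
    | zero => simp
    | succ k ih =>
      rw [Nat.mul_succ, Finset.sum_range_add, ih, Finset.sum_range_succ, mul_add]
      congr 1
      rw [Finset.sum_congr rfl (g := fun _ => g k)]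
      · simp
      · intro n hn
        rw [Nat.mul_add_div hm, Nat.div_eq_of_lt (Finset.mem_range.1 hn), add_zero]
  rw [← h1]
  exact Finset.sum_le_sum_of_subset_of_nonneg
    (Finset.range_subset_range.2 (Nat.le_mul_of_pos_left k hm)) fun n _ _ => h0 _

end SequenceSpaces

/-! ### Diagonal operators on an orthonormal sequence. -/

section Diagonal

variable {H : Type u} [NormedAddCommGroup H] [InnerProductSpace ℂ H]

/-- The bound on `ξ` is asked only where the coefficient of `v` is nonzero. This covers both tails
of the series and vectors orthogonal to the first few `e i`. -/
theorem Orthonormal.norm_sum_smul_le {ι : Type*} {e : ι → H} (he : Orthonormal ℂ e) {ξ : ι → ℝ}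
    {C : ℝ} (hC : 0 ≤ C) (s : Finset ι) (v : H)
    (h : ∀ i ∈ s, inner ℂ (e i) v ≠ 0 → |ξ i| ≤ C) :
    ‖∑ i ∈ s, (ξ i : ℂ) • inner ℂ (e i) v • e i‖ ≤ C * ‖v‖ := by
  refine le_of_sq_le_sq ?_ (by positivity)
  have h1 : ‖∑ i ∈ s, (ξ i : ℂ) • inner ℂ (e i) v • e i‖ ^ 2 =
      ∑ i ∈ s, ‖(ξ i : ℂ) * inner ℂ (e i) v‖ ^ 2 := by
    have h2 := he.inner_sum (fun i => (ξ i : ℂ) * inner ℂ (e i) v)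
      (fun i => (ξ i : ℂ) * inner ℂ (e i) v) s
    simp only [← smul_smul] at h2
    rw [inner_self_eq_norm_sq_to_K] at h2
    have h3 : ((‖∑ i ∈ s, (ξ i : ℂ) • inner ℂ (e i) v • e i‖ ^ 2 : ℝ) : ℂ) =
        ((∑ i ∈ s, ‖(ξ i : ℂ) * inner ℂ (e i) v‖ ^ 2 : ℝ) : ℂ) := by
      push_cast
      refine h2.trans (Finset.sum_congr rfl fun i _ => ?_)
      rw [Complex.conj_mul']
    exact_mod_cast h3
  rw [h1, mul_pow]
  calc ∑ i ∈ s, ‖(ξ i : ℂ) * inner ℂ (e i) v‖ ^ 2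
      ≤ ∑ i ∈ s, C ^ 2 * ‖inner ℂ (e i) v‖ ^ 2 := by
        refine Finset.sum_le_sum fun i hi => ?_
        rw [norm_mul, mul_pow, Complex.norm_real, Real.norm_eq_abs]
        by_cases hz : inner ℂ (e i) v = 0
        · simp [hz]
        · have := h i hi hz
          gcongr
    _ = C ^ 2 * ∑ i ∈ s, ‖inner ℂ (e i) v‖ ^ 2 := by rw [Finset.mul_sum]
    _ ≤ C ^ 2 * ‖v‖ ^ 2 := by
        gcongr
        exact he.sum_inner_products_le v

variable [CompleteSpace H]

/-- The finite sections are Cauchy in norm because a tail starting at `m` has norm at most `ξ m`.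
The second clause places the range in the closed span of `e`; it later removes the term `xa` from
the matrix entries of the commutator. -/
theorem exists_diagonal_operator {e : ℕ → H} (he : Orthonormal ℂ e) {ξ : ℕ → ℝ} (hξ : Antitone ξ)
    (h0 : 0 ≤ ξ) (hlim : Tendsto ξ atTop (𝓝 0)) :
    ∃ x : H →L[ℂ] H, (∀ n, x (e n) = (ξ n : ℂ) • e n) ∧
      (∀ f v, (∀ n, inner ℂ f (e n) = 0) → inner ℂ f (x v) = 0) ∧
      IsCompactOperator x ∧ ∀ n, singularValue x n ≤ ξ n := by
  classical
  let S : ℕ → H →L[ℂ] H := fun N =>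
    ∑ n ∈ Finset.range N, (ξ n : ℂ) • InnerProductSpace.rankOne ℂ (e n) (e n)
  have hS : ∀ N v, S N v = ∑ n ∈ Finset.range N, (ξ n : ℂ) • inner ℂ (e n) v • e n := by
    intro N v
    simp [S]
  have hle : ∀ m N, m ≤ N → ‖S N - S m‖ ≤ ξ m := by
    intro m N hmN
    refine ContinuousLinearMap.opNorm_le_bound _ (h0 m) fun v => ?_
    rw [sub_apply, hS, hS, ← Finset.sum_Ico_eq_sub _ hmN]
    refine he.norm_sum_smul_le (h0 m) _ v fun i hi _ => ?_
    rw [abs_of_nonneg (h0 i)]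
    exact hξ (Finset.mem_Ico.1 hi).1
  have hC : CauchySeq S := by
    refine cauchySeq_of_le_tendsto_0 (fun N => 2 * ξ N) (fun m n N hm hn => ?_)
      (by simpa using hlim.const_mul 2)
    have h1 := hle N m hm
    have h2 := hle N n hn
    calc dist (S m) (S n) ≤ dist (S m) (S N) + dist (S N) (S n) := dist_triangle _ _ _
      _ ≤ 2 * ξ N := by rw [dist_eq_norm, dist_comm, dist_eq_norm]; linarith
  obtain ⟨x, hx⟩ := cauchySeq_tendsto_of_complete hC
  have hxv : ∀ v, Tendsto (fun N => S N v) atTop (𝓝 (x v)) := fun v =>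
    ((ContinuousLinearMap.apply ℂ H v).continuous.tendsto x).comp hx
  -- Only coefficients with index at least `n` survive here. The estimate yields both compactness
  -- and the bound on the singular values.
  have hspan : ∀ n v, v ∈ (Submodule.span ℂ ((Finset.range n).image e : Set H))ᗮ →
      ‖x v‖ ≤ ξ n * ‖v‖ := by
    intro n v hv
    refine le_of_tendsto (hxv v).norm (.of_forall fun N => ?_)
    rw [hS]
    refine he.norm_sum_smul_le (h0 n) _ v fun i _ hi => ?_
    rw [abs_of_nonneg (h0 i)]
    refine hξ (not_lt.1 fun hlt => hi (hv _ (Submodule.subset_span ?_)))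
    simp only [Finset.coe_image, Finset.coe_range]
    exact ⟨i, by simpa using hlt, rfl⟩
  refine ⟨x, fun n => ?_, fun f v hf => ?_, ?_, fun n => ?_⟩
  · refine tendsto_nhds_unique (hxv (e n)) (tendsto_const_nhds.congr' ?_)
    filter_upwards [eventually_gt_atTop n] with N hN
    rw [hS, Finset.sum_eq_single n]
    · rw [inner_self_eq_norm_sq_to_K, he.1 n]; simp
    · intro m _ hmn
      rw [he.2 hmn]; simp
    · intro h; exact absurd (Finset.mem_range.2 hN) h
  · refine tendsto_nhds_unique (((innerSL ℂ f).continuous.tendsto _).comp (hxv v))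
      (tendsto_const_nhds.congr fun N => ?_)
    simp only [Function.comp_apply, innerSL_apply_apply, hS, inner_sum, inner_smul_right, hf,
      mul_zero, Finset.sum_const_zero]
  · refine (isCompactOperator_of_forall_exists_le fun ε hε => ?_).1
    obtain ⟨n, hn⟩ := (hlim.eventually_lt_const hε).exists
    exact ⟨_, FiniteDimensional.span_finset ℂ _, fun v hv => (hspan n v hv).trans (by gcongr)⟩
  · refine le_of_forall_gt_imp_ge_of_dense fun r hr => ?_
    refine singularValue_le _ n ((h0 n).trans_lt hr) _ ?_
      fun v hv => (hspan n v hv).trans (by gcongr)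
    refine (rank_span_finset_le _).trans ?_
    exact_mod_cast Finset.card_image_le.trans (Finset.card_range n).le

end Diagonal

/-! ### Off-diagonal entries and the greedy choice of vectors. -/

section Greedy

variable {H : Type u} [NormedAddCommGroup H] [InnerProductSpace ℂ H]

/-- The largest off-diagonal matrix entry of `a` with respect to pairs of orthonormal vectors
orthogonal to `F`. -/
noncomputable def offDiag (a : H →L[ℂ] H) (F : Submodule ℂ H) : ℝ :=
  sSup {r : ℝ | ∃ e ∈ Fᗮ, ∃ f ∈ Fᗮ, ‖e‖ = 1 ∧ ‖f‖ = 1 ∧ inner ℂ f e = 0 ∧ r = ‖inner ℂ f (a e)‖}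

theorem bddAbove_offDiag (a : H →L[ℂ] H) (F : Submodule ℂ H) :
    BddAbove {r : ℝ | ∃ e ∈ Fᗮ, ∃ f ∈ Fᗮ, ‖e‖ = 1 ∧ ‖f‖ = 1 ∧ inner ℂ f e = 0 ∧
      r = ‖inner ℂ f (a e)‖} := by
  refine ⟨‖a‖, ?_⟩
  rintro r ⟨e, -, f, -, he, hf, -, rfl⟩
  refine (norm_inner_le_norm _ _).trans ?_
  rw [hf, one_mul]
  simpa [he] using a.le_opNorm e

theorem norm_inner_le_offDiag (a : H →L[ℂ] H) {F : Submodule ℂ H} {v w : H} (hv : v ∈ Fᗮ)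
    (hw : w ∈ Fᗮ) (hvw : inner ℂ w v = 0) : ‖inner ℂ w (a v)‖ ≤ offDiag a F * ‖v‖ * ‖w‖ := by
  rcases eq_or_ne v 0 with rfl | hv0
  · simp
  rcases eq_or_ne w 0 with rfl | hw0
  · simp
  have hv1 : 0 < ‖v‖ := norm_pos_iff.2 hv0
  have hw1 : 0 < ‖w‖ := norm_pos_iff.2 hw0
  have h1 : ‖inner ℂ (((‖w‖⁻¹ : ℝ) : ℂ) • w) (a (((‖v‖⁻¹ : ℝ) : ℂ) • v))‖ ≤ offDiag a F := by
    refine le_csSup (bddAbove_offDiag a F) ⟨_, Submodule.smul_mem _ _ hv, _,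
      Submodule.smul_mem _ _ hw, ?_, ?_, ?_, rfl⟩
    · rw [norm_smul, Complex.norm_real, Real.norm_of_nonneg (by positivity),
        inv_mul_cancel₀ hv1.ne']
    · rw [norm_smul, Complex.norm_real, Real.norm_of_nonneg (by positivity),
        inv_mul_cancel₀ hw1.ne']
    · rw [inner_smul_left, inner_smul_right, hvw, mul_zero, mul_zero]
  rw [map_smul, inner_smul_left, inner_smul_right, norm_mul, norm_mul, Complex.conj_ofReal,
    Complex.norm_real, Complex.norm_real, Real.norm_of_nonneg (by positivity),
    Real.norm_of_nonneg (by positivity), ← mul_assoc, ← mul_inv, ← div_eq_inv_mul,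
    div_le_iff₀ (by positivity)] at h1
  linarith

theorem exists_unit_mem_orthogonal (hH : ¬ FiniteDimensional ℂ H) (F : Submodule ℂ H)
    [FiniteDimensional ℂ F] : ∃ e ∈ Fᗮ, ‖e‖ = 1 := by
  have hne : Fᗮ ≠ ⊥ := by
    intro h
    rw [Submodule.orthogonal_eq_bot_iff] at h
    subst h
    exact hH (LinearEquiv.finiteDimensional (Submodule.topEquiv (R := ℂ) (M := H)))
  obtain ⟨v, hv, hv0⟩ := Submodule.exists_mem_ne_zero_of_ne_bot hne
  have hv1 : 0 < ‖v‖ := norm_pos_iff.2 hv0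
  refine ⟨((‖v‖⁻¹ : ℝ) : ℂ) • v, Submodule.smul_mem _ _ hv, ?_⟩
  rw [norm_smul, Complex.norm_real, Real.norm_of_nonneg (by positivity), inv_mul_cancel₀ hv1.ne']

theorem exists_orthonormal_pair (hH : ¬ FiniteDimensional ℂ H) (F : Submodule ℂ H)
    [FiniteDimensional ℂ F] :
    ∃ e ∈ Fᗮ, ∃ f ∈ Fᗮ, ‖e‖ = 1 ∧ ‖f‖ = 1 ∧ inner ℂ f e = 0 := by
  obtain ⟨e, he, he1⟩ := exists_unit_mem_orthogonal hH F
  obtain ⟨f, hf, hf1⟩ := exists_unit_mem_orthogonal hH (F ⊔ ℂ ∙ e)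
  refine ⟨e, he, f, Submodule.orthogonal_le le_sup_left hf, he1, hf1, ?_⟩
  exact (Submodule.mem_orthogonal' _ _).1 hf e
    (Submodule.mem_sup_right (Submodule.mem_span_singleton_self e))

theorem offDiag_nonneg (a : H →L[ℂ] H) (F : Submodule ℂ H) : 0 ≤ offDiag a F := by
  refine Real.sSup_nonneg ?_
  rintro r ⟨e, -, f, -, -, -, -, rfl⟩
  exact norm_nonneg _

theorem offDiag_anti (hH : ¬ FiniteDimensional ℂ H) (a : H →L[ℂ] H) {F G : Submodule ℂ H}
    [FiniteDimensional ℂ G] (h : F ≤ G) : offDiag a G ≤ offDiag a F := by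
  refine csSup_le_csSup (bddAbove_offDiag a F) ?_ ?_
  · obtain ⟨e, he, f, hf, he1, hf1, hef⟩ := exists_orthonormal_pair hH G
    exact ⟨_, e, he, f, hf, he1, hf1, hef, rfl⟩
  · rintro r ⟨e, he, f, hf, hr⟩
    exact ⟨e, Submodule.orthogonal_le h he, f, Submodule.orthogonal_le h hf, hr⟩

/-- The supremum need not be attained, so half of it is reached instead. When it is 0, any
orthonormal pair serves. -/
theorem exists_pair_offDiag_le (hH : ¬ FiniteDimensional ℂ H) (a : H →L[ℂ] H)
    (F : Submodule ℂ H) [FiniteDimensional ℂ F] :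
    ∃ e f : H, e ∈ Fᗮ ∧ f ∈ Fᗮ ∧ ‖e‖ = 1 ∧ ‖f‖ = 1 ∧ inner ℂ f e = 0 ∧
      offDiag a F ≤ 2 * ‖inner ℂ f (a e)‖ := by
  obtain ⟨e, he, f, hf, he1, hf1, hef⟩ := exists_orthonormal_pair hH F
  rcases (offDiag_nonneg a F).eq_or_lt with h | h
  · exact ⟨e, f, he, hf, he1, hf1, hef, by rw [← h]; positivity⟩
  · have hlt : offDiag a F / 2 < offDiag a F := by linarith
    obtain ⟨r, ⟨e', he', f', hf', h1, h2, h3, rfl⟩, hr⟩ :=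
      exists_lt_of_lt_csSup (by exact ⟨_, e, he, f, hf, he1, hf1, hef, rfl⟩) hlt
    exact ⟨e', f', he', hf', h1, h2, h3, by linarith⟩

/-- `G n` is spanned by the first `n` pairs, and the next pair is a nearly optimal one in its
orthogonal complement. -/
theorem exists_greedy_sequence (hH : ¬ FiniteDimensional ℂ H) (a : H →L[ℂ] H) :
    ∃ (G : ℕ → Submodule ℂ H) (e f : ℕ → H), Monotone G ∧
      (∀ n, Module.rank ℂ (G n) ≤ ((2 * n : ℕ) : Cardinal)) ∧
      Orthonormal ℂ e ∧ Orthonormal ℂ f ∧ (∀ m n, inner ℂ (f m) (e n) = 0) ∧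
      (∀ n, e n ∈ (G n)ᗮ) ∧ ∀ n, offDiag a (G n) ≤ 2 * ‖inner ℂ (f n) (a (e n))‖ := by
  choose E F hE hF hE1 hF1 hEF hD using
    fun K : {K : Submodule ℂ H // FiniteDimensional ℂ K} =>
      have := K.2; exists_pair_offDiag_le hH a K.1
  let step : {K : Submodule ℂ H // FiniteDimensional ℂ K} →
      {K : Submodule ℂ H // FiniteDimensional ℂ K} := fun K =>
    ⟨K.1 ⊔ ((ℂ ∙ E K) ⊔ (ℂ ∙ F K)), by have := K.2; infer_instance⟩
  let G : ℕ → {K : Submodule ℂ H // FiniteDimensional ℂ K} := fun n =>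
    n.rec ⟨⊥, inferInstance⟩ fun _ K => step K
  have hG : ∀ n, (G (n + 1)).1 = (G n).1 ⊔ ((ℂ ∙ E (G n)) ⊔ (ℂ ∙ F (G n))) := fun n => rfl
  have hmono : Monotone fun n => (G n).1 :=
    monotone_nat_of_le_succ fun n => by rw [hG]; exact le_sup_left
  have hEmem : ∀ m n, m < n → E (G m) ∈ (G n).1 := fun m n hmn => by
    refine hmono (Nat.succ_le_of_lt hmn) ?_
    change _ ∈ (G (m + 1)).1
    rw [hG]
    exact Submodule.mem_sup_right (Submodule.mem_sup_left (Submodule.mem_span_singleton_self _))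
  have hFmem : ∀ m n, m < n → F (G m) ∈ (G n).1 := fun m n hmn => by
    refine hmono (Nat.succ_le_of_lt hmn) ?_
    change _ ∈ (G (m + 1)).1
    rw [hG]
    exact Submodule.mem_sup_right (Submodule.mem_sup_right (Submodule.mem_span_singleton_self _))
  have hsymm : ∀ u v : H, inner ℂ u v = 0 → inner ℂ v u = 0 := fun u v h =>
    inner_eq_zero_symm.1 h
  refine ⟨fun n => (G n).1, fun n => E (G n), fun n => F (G n), hmono, fun n => ?_,
    ⟨fun n => hE1 _, fun m n hmn => ?_⟩, ⟨fun n => hF1 _, fun m n hmn => ?_⟩, fun m n => ?_,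
    fun n => hE _, fun n => hD _⟩
  · induction n with
    | zero =>
      change Module.rank ℂ (⊥ : Submodule ℂ H) ≤ _
      rw [rank_bot]; exact zero_le
    | succ n ih =>
      change Module.rank ℂ (G (n + 1)).1 ≤ _
      rw [hG]
      have h1 : ∀ v : H, Module.rank ℂ (ℂ ∙ v) ≤ 1 := fun v =>
        (rank_span_le _).trans (Cardinal.mk_singleton v).le
      refine (Submodule.rank_add_le_rank_add_rank _ _).trans ((add_le_add ih
        ((Submodule.rank_add_le_rank_add_rank _ _).trans (add_le_add (h1 _) (h1 _)))).trans ?_)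
      have : ((2 * n : ℕ) : Cardinal.{u}) + (1 + 1) = ((2 * (n + 1) : ℕ) : Cardinal.{u}) := by
        push_cast; ring
      exact this.le
  · rcases hmn.lt_or_gt with h | h
    · exact hE (G n) _ (hEmem m n h)
    · exact hsymm _ _ (hE (G m) _ (hEmem n m h))
  · rcases hmn.lt_or_gt with h | h
    · exact hF (G n) _ (hFmem m n h)
    · exact hsymm _ _ (hF (G m) _ (hFmem n m h))
  · rcases lt_trichotomy m n with h | h | h
    · exact hE (G n) _ (hFmem m n h)
    · rw [h]; exact hEF _
    · exact hsymm _ _ (hF (G m) _ (hEmem n m h))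

/-- If all off-diagonal entries of `a` on `Fᗮ` are small, then the compression of `a` to `Fᗮ` is
close to a scalar, namely to any diagonal entry. -/
theorem norm_inner_sub_le_offDiag (a : H →L[ℂ] H) {F : Submodule ℂ H} {e v w : H} (he : e ∈ Fᗮ)
    (he1 : ‖e‖ = 1) (hv : v ∈ Fᗮ) (hw : w ∈ Fᗮ) :
    ‖inner ℂ w (a v) - inner ℂ e (a e) * inner ℂ w v‖ ≤ 6 * offDiag a F * ‖v‖ * ‖w‖ := by
  set D := offDiag a F with hD
  have hD0 : 0 ≤ D := offDiag_nonneg a F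
  set l := inner ℂ e (a e) with hl
  -- The vectors `e + f` and `e - f` are orthogonal, so their entry is off-diagonal and at most `2
  -- D`. Its expansion contains the difference of the two diagonal entries and two further
  -- off-diagonal entries, for a total of `2 D + D + D`.
  have hunit : ∀ f ∈ Fᗮ, ‖f‖ = 1 → inner ℂ f e = 0 → ‖inner ℂ f (a f) - l‖ ≤ 4 * D := by
    intro f hf hf1 hfe
    have hef := inner_eq_zero_symm.1 hfe
    have h1 := norm_inner_le_offDiag a (Submodule.add_mem _ he hf) (Submodule.sub_mem _ he hf)
      (by
        rw [inner_sub_left, inner_add_right, inner_add_right, hef, hfe, inner_self_eq_norm_sq_to_K,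
          inner_self_eq_norm_sq_to_K, he1, hf1]
        simp)
    have h2 := norm_inner_le_offDiag a hf he hef
    have h3 := norm_inner_le_offDiag a he hf hfe
    rw [he1, hf1, mul_one, mul_one] at h2 h3
    have h4 : ‖e + f‖ * ‖e - f‖ ≤ 2 := by
      have := parallelogram_law_with_norm ℂ e f
      rw [he1, hf1] at this
      nlinarith [sq_nonneg (‖e + f‖ - ‖e - f‖)]
    have h5 : inner ℂ f (a f) - l = -inner ℂ (e - f) (a (e + f)) +
        (inner ℂ e (a f) - inner ℂ f (a e)) := by
      rw [map_add, inner_sub_left, inner_add_right, inner_add_right, hl]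
      ring
    rw [h5]
    refine (norm_add_le _ _).trans ?_
    rw [norm_neg]
    have h6 := norm_sub_le (inner ℂ e (a f)) (inner ℂ f (a e))
    have h7 : D * ‖e + f‖ * ‖e - f‖ ≤ D * 2 := by
      rw [mul_assoc]; gcongr
    linarith
  have horth : ∀ u ∈ Fᗮ, inner ℂ u e = 0 →
      ‖inner ℂ u (a u) - l * (‖u‖ : ℂ) ^ 2‖ ≤ 4 * D * ‖u‖ ^ 2 := by
    intro u hu hue
    rcases eq_or_ne u 0 with rfl | hu0
    · simp
    have hu1 : 0 < ‖u‖ := norm_pos_iff.2 hu0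
    have h1 := hunit (((‖u‖⁻¹ : ℝ) : ℂ) • u) (Submodule.smul_mem _ _ hu)
      (by rw [norm_smul, Complex.norm_real, Real.norm_of_nonneg (by positivity),
        inv_mul_cancel₀ hu1.ne'])
      (by rw [inner_smul_left, hue, mul_zero])
    have hne : (‖u‖ : ℂ) ≠ 0 := by exact_mod_cast hu1.ne'
    have h2 : inner ℂ u (a u) - l * (‖u‖ : ℂ) ^ 2 = (‖u‖ : ℂ) ^ 2 *
        (inner ℂ (((‖u‖⁻¹ : ℝ) : ℂ) • u) (a (((‖u‖⁻¹ : ℝ) : ℂ) • u)) - l) := by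
      rw [map_smul, inner_smul_left, inner_smul_right, Complex.conj_ofReal]
      push_cast
      field_simp
    rw [h2, norm_mul, norm_pow, Complex.norm_real, norm_norm, mul_comm]
    gcongr
  -- Write `v = α e + u` with `u ⊥ e`. The cross terms add at most `2 D ‖α‖ ‖u‖ ≤ D (‖α‖² + ‖u‖²)`
  -- to `4 D ‖u‖²`.
  have hquad : ∀ v ∈ Fᗮ, ‖inner ℂ v (a v) - l * (‖v‖ : ℂ) ^ 2‖ ≤ 5 * D * ‖v‖ ^ 2 := by
    intro v hv
    set α := inner ℂ e v with hα
    set u := v - α • e with hu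
    have hue : inner ℂ e u = 0 := by
      rw [hu, inner_sub_right, inner_smul_right, inner_self_eq_norm_sq_to_K, he1, ← hα]; simp
    have hue' := inner_eq_zero_symm.1 hue
    have huF : u ∈ Fᗮ := Submodule.sub_mem _ hv (Submodule.smul_mem _ _ he)
    have hvu : v = α • e + u := by rw [hu]; abel
    have hnorm : ‖v‖ ^ 2 = ‖α‖ ^ 2 + ‖u‖ ^ 2 := by
      have := norm_add_sq_eq_norm_sq_add_norm_sq_of_inner_eq_zero (𝕜 := ℂ) (α • e) u
        (by rw [inner_smul_left, hue, mul_zero])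
      rw [← hvu, norm_smul, he1, mul_one] at this
      nlinarith
    have hnormc : (‖v‖ : ℂ) ^ 2 = (starRingEnd ℂ) α * α + (‖u‖ : ℂ) ^ 2 := by
      rw [Complex.conj_mul']; exact_mod_cast hnorm
    have h1 : inner ℂ v (a v) - l * (‖v‖ : ℂ) ^ 2 = (inner ℂ u (a u) - l * (‖u‖ : ℂ) ^ 2) +
        ((starRingEnd ℂ) α * inner ℂ e (a u) + α * inner ℂ u (a e)) := by
      rw [hnormc]
      conv_lhs => rw [hvu]
      rw [map_add, map_smul, inner_add_left, inner_add_right, inner_add_right, inner_smul_left,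
        inner_smul_left, inner_smul_right, inner_smul_right, ← hl]
      ring
    have h2 := norm_inner_le_offDiag a huF he hue
    have h3 := norm_inner_le_offDiag a he huF hue'
    rw [he1, mul_one] at h2 h3
    have h4 : ‖(starRingEnd ℂ) α * inner ℂ e (a u) + α * inner ℂ u (a e)‖ ≤
        2 * (D * ‖u‖ * ‖α‖) := by
      refine (norm_add_le _ _).trans ?_
      rw [norm_mul, norm_mul, RCLike.norm_conj]
      have := mul_le_mul_of_nonneg_left h2 (norm_nonneg α)
      have := mul_le_mul_of_nonneg_left h3 (norm_nonneg α)
      linarith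
    rw [h1]
    refine (norm_add_le _ _).trans ((add_le_add (horth u huF hue') h4).trans ?_)
    rw [hnorm]
    nlinarith [mul_nonneg hD0 (sq_nonneg (‖u‖ - ‖α‖)), mul_nonneg hD0 (sq_nonneg ‖α‖)]
  rcases eq_or_ne v 0 with rfl | hv0
  · simp
  have hv1 : 0 < ‖v‖ := norm_pos_iff.2 hv0
  have hvc : (‖v‖ : ℂ) ≠ 0 := by exact_mod_cast hv1.ne'
  -- Decompose `w = c v + u` with `u ⊥ v`. The first part costs `5 D` by `hquad`, and the second is
  -- one more off-diagonal entry.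
  set c := inner ℂ v w / (‖v‖ : ℂ) ^ 2 with hc
  set u := w - c • v with hu
  have hvu : inner ℂ v u = 0 := by
    rw [hu, inner_sub_right, inner_smul_right, inner_self_eq_norm_sq_to_K, hc]
    field_simp
    simp
  have huF : u ∈ Fᗮ := Submodule.sub_mem _ hw (Submodule.smul_mem _ _ hv)
  have hwu : w = c • v + u := by rw [hu]; abel
  have hpyth := norm_add_sq_eq_norm_sq_add_norm_sq_of_inner_eq_zero (𝕜 := ℂ) (c • v) u
    (by rw [inner_smul_left, hvu, mul_zero])
  rw [← hwu, norm_smul] at hpyth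
  have hcw : ‖c‖ * ‖v‖ ≤ ‖w‖ :=
    le_of_sq_le_sq (by nlinarith [mul_self_nonneg ‖u‖]) (norm_nonneg _)
  have huw : ‖u‖ ≤ ‖w‖ :=
    le_of_sq_le_sq (by nlinarith [mul_self_nonneg (‖c‖ * ‖v‖)]) (norm_nonneg _)
  have h1 : inner ℂ w (a v) - l * inner ℂ w v =
      (starRingEnd ℂ) c * (inner ℂ v (a v) - l * (‖v‖ : ℂ) ^ 2) + inner ℂ u (a v) := by
    conv_lhs => rw [hwu]
    rw [inner_add_left, inner_add_left, inner_smul_left, inner_smul_left,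
      inner_self_eq_norm_sq_to_K, inner_eq_zero_symm.1 hvu]
    simp only [Complex.coe_algebraMap]
    ring
  have h2 := norm_inner_le_offDiag a hv huF (inner_eq_zero_symm.1 hvu)
  have h3 := hquad v hv
  rw [h1]
  refine (norm_add_le _ _).trans ?_
  rw [norm_mul, RCLike.norm_conj]
  calc ‖c‖ * ‖inner ℂ v (a v) - l * (‖v‖ : ℂ) ^ 2‖ + ‖inner ℂ u (a v)‖
      ≤ ‖c‖ * (5 * D * ‖v‖ ^ 2) + D * ‖v‖ * ‖u‖ := by gcongr
    _ = 5 * D * ‖v‖ * (‖c‖ * ‖v‖) + D * ‖v‖ * ‖u‖ := by ring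
    _ ≤ 5 * D * ‖v‖ * ‖w‖ + D * ‖v‖ * ‖w‖ := by gcongr
    _ = _ := by ring

end Greedy

/-! ### From derivations to operators in the Marcinkiewicz ideal. -/

section Derivations

variable {H : Type u} [NormedAddCommGroup H] [InnerProductSpace ℂ H] [CompleteSpace H]

local postfix:max "†" => ContinuousLinearMap.adjoint

/-- For `m ≥ n` both `e m` and `e n` are orthogonal to `G n`, so the diagonal entries differ by at
most `6 D n` and converge to some `l`. Passing from the `n`-th entry to `l` costs another `6 D n`,
hence the factor 12. -/
theorem exists_sub_scalar_le (a : H →L[ℂ] H)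
    {G : ℕ → Submodule ℂ H} {e : ℕ → H} (hG : Monotone G)
    (hrank : ∀ n, Module.rank ℂ (G n) ≤ ((2 * n : ℕ) : Cardinal)) (he1 : ∀ n, ‖e n‖ = 1)
    (he : ∀ n, e n ∈ (G n)ᗮ) (hlim : Tendsto (fun n => offDiag a (G n)) atTop (𝓝 0)) :
    ∃ l : ℂ, ∀ n, ∃ F : Submodule ℂ H, Module.rank ℂ F ≤ ((4 * n : ℕ) : Cardinal) ∧
      ∀ v ∈ Fᗮ, ‖(a - l • 1 : H →L[ℂ] H) v‖ ≤ 12 * offDiag a (G n) * ‖v‖ := by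
  set D : ℕ → ℝ := fun n => offDiag a (G n) with hD
  set l : ℕ → ℂ := fun n => inner ℂ (e n) (a (e n)) with hl
  have hmem : ∀ {m n : ℕ}, n ≤ m → e m ∈ (G n)ᗮ := fun hnm =>
    Submodule.orthogonal_le (hG hnm) (he _)
  have hl1 : ∀ n m, n ≤ m → ‖l m - l n‖ ≤ 6 * D n := by
    intro n m hnm
    have h1 := norm_inner_sub_le_offDiag a (hmem hnm) (he1 m) (he n) (he n)
    rw [inner_self_eq_norm_sq_to_K, he1 n] at h1
    rw [norm_sub_rev]
    simpa using h1
  have hC : CauchySeq l := by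
    refine cauchySeq_of_le_tendsto_0 (fun N => 12 * D N) (fun m n N hm hn => ?_)
      (by simpa using hlim.const_mul 12)
    have h1 := hl1 N m hm
    have h2 := hl1 N n hn
    calc dist (l m) (l n) ≤ dist (l m) (l N) + dist (l N) (l n) := dist_triangle _ _ _
      _ ≤ 12 * D N := by rw [dist_eq_norm, dist_comm, dist_eq_norm]; linarith
  obtain ⟨L, hL⟩ := cauchySeq_tendsto_of_complete hC
  have hL1 : ∀ n, ‖L - l n‖ ≤ 6 * D n := fun n =>
    le_of_tendsto (hL.sub_const (l n)).norm
      ((eventually_ge_atTop n).mono fun m hm => hl1 n m hm)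
  refine ⟨L, fun n => ?_⟩
  set z : H →L[ℂ] H := a - L • 1 with hz
  -- The second summand ensures that `z v` is also orthogonal to `G n`. The compression estimate can
  -- then be tested with `w = z v`, which bounds `‖z v‖²`. The rank doubles from `2 n` to `4 n`.
  refine ⟨G n ⊔ (G n).map (z† : H →ₗ[ℂ] H), ?_, fun v hv => ?_⟩
  · refine (Submodule.rank_add_le_rank_add_rank _ _).trans
      ((add_le_add (hrank n) ((rank_map_le _ _).trans (hrank n))).trans ?_)
    have : 2 * n + 2 * n = 4 * n := by omega
    exact_mod_cast this.le
  · have v1 := Submodule.orthogonal_le le_sup_left hv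
    have v2 := Submodule.orthogonal_le le_sup_right hv
    have v3 : z v ∈ (G n)ᗮ := by
      rw [Submodule.mem_orthogonal]
      intro u hu
      rw [← ContinuousLinearMap.adjoint_inner_left]
      exact v2 _ (Submodule.mem_map_of_mem hu)
    have h1 := norm_inner_sub_le_offDiag a (he n) (he1 n) v1 v3
    have h2 : ((‖z v‖ ^ 2 : ℝ) : ℂ) = (inner ℂ (z v) (a v) - l n * inner ℂ (z v) v) -
        (L - l n) * inner ℂ (z v) v := by
      have h3 : inner ℂ (z v) (z v) = ((‖z v‖ ^ 2 : ℝ) : ℂ) := by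
        rw [inner_self_eq_norm_sq_to_K]; push_cast; rfl
      rw [← h3]
      conv_lhs =>
        arg 3
        rw [hz]
      rw [sub_apply, inner_sub_right, smul_apply, inner_smul_right, one_apply_eq_self]
      ring
    have h4 : ‖z v‖ ^ 2 ≤ 12 * D n * ‖v‖ * ‖z v‖ := by
      have h5 : ‖((‖z v‖ ^ 2 : ℝ) : ℂ)‖ = ‖z v‖ ^ 2 := by
        rw [Complex.norm_real, Real.norm_of_nonneg (by positivity)]
      rw [← h5, h2]
      refine (norm_sub_le _ _).trans ?_
      have h6 : ‖(L - l n) * inner ℂ (z v) v‖ ≤ 6 * D n * (‖z v‖ * ‖v‖) := by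
        rw [norm_mul]
        exact mul_le_mul (hL1 n) (norm_inner_le_norm _ _) (norm_nonneg _)
          ((norm_nonneg _).trans (hL1 n))
      linarith
    rcases (norm_nonneg (z v)).eq_or_lt with h | h
    · rw [← h]
      have := offDiag_nonneg a (G n)
      positivity
    · rw [pow_two] at h4
      exact le_of_mul_le_mul_right h4 h

/-- The hypothesis gives `s_n(z) ≤ 12 d_{n/4}`. Each `d_j` occurs at most four times, so the partial
sums of `s_n(z)^p` are at most `12^p · 4M` times those of `ω`. -/
theorem mem_marcinkiewicz_of_le {p : ℝ} (hp : 1 ≤ p) {ω : ℕ → ℝ} (hω : IsWeight ω)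
    {z : H →L[ℂ] H} {d : ℕ → ℝ} (h0 : 0 ≤ d) (hlim : Tendsto d atTop (𝓝 0))
    {M : ℝ} (hd : ∀ k, ∑ n ∈ Finset.range k, d n ^ p ≤ M * ∑ n ∈ Finset.range k, ω n)
    (hF : ∀ n, ∃ F : Submodule ℂ H, Module.rank ℂ F ≤ ((4 * n : ℕ) : Cardinal) ∧
      ∀ v ∈ Fᗮ, ‖z v‖ ≤ 12 * d n * ‖v‖) :
    z ∈ opClass H (seqSpace (marcinkiewiczNorm p ω)) := by
  have hp0 : 0 < p := zero_lt_one.trans_le hp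
  have hs : ∀ n, singularValue z n ≤ 12 * d (n / 4) := by
    intro n
    obtain ⟨F, hFr, hFv⟩ := hF (n / 4)
    refine (singularValue_antitone z (Nat.mul_div_le n 4)).trans ?_
    refine le_of_forall_gt_imp_ge_of_dense fun r hr => ?_
    have hd0 := h0 (n / 4)
    simp only [Pi.zero_apply] at hd0
    exact singularValue_le z _ (lt_of_le_of_lt (by positivity) hr) F hFr
      fun v hv => (hFv v hv).trans (by gcongr)
  have hlim' : Tendsto (fun n => 12 * d (n / 4)) atTop (𝓝 0) := by
    have := (hlim.comp (Nat.tendsto_div_const_atTop (n := 4) (by norm_num))).const_mul 12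
    simpa using this
  refine ⟨(isCompactOperator_of_forall_exists_le fun ε hε => ?_).1,
    squeeze_zero (singularValue_nonneg z) hs hlim', ?_⟩
  · have h1 : Tendsto (fun n => 12 * d n) atTop (𝓝 0) := by simpa using hlim.const_mul 12
    obtain ⟨n, hn⟩ := (h1.eventually_lt_const hε).exists
    obtain ⟨F, hFr, hFv⟩ := hF n
    exact ⟨F, Module.rank_lt_aleph0_iff.1 (hFr.trans_lt Cardinal.natCast_lt_aleph0),
      fun v hv => (hFv v hv).trans (by gcongr)⟩
  · change opNorm (marcinkiewiczNorm p ω) z < ∞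
    rw [opNorm_marcinkiewiczNorm]
    refine lt_of_le_of_lt (iSup_le fun k => ?_)
      (ENNReal.ofReal_lt_top (r := (12 ^ p * (4 * M)) ^ (1 / p)))
    have hW : 0 < ∑ n ∈ Finset.range (k + 1), ω n :=
      Finset.sum_pos (fun n _ => hω.pos n) ⟨0, by simp⟩
    have hS : 0 ≤ ∑ n ∈ Finset.range (k + 1), singularValue z n ^ p :=
      Finset.sum_nonneg fun n _ => Real.rpow_nonneg (singularValue_nonneg z n) p
    refine ENNReal.ofReal_le_ofReal (Real.rpow_le_rpow (by positivity) ?_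
      (one_div_nonneg.2 hp0.le))
    rw [div_le_iff₀ hW]
    calc ∑ n ∈ Finset.range (k + 1), singularValue z n ^ p
        ≤ ∑ n ∈ Finset.range (k + 1), 12 ^ p * d (n / 4) ^ p := by
          refine Finset.sum_le_sum fun n _ => ?_
          rw [← Real.mul_rpow (by norm_num) (h0 _)]
          exact Real.rpow_le_rpow (singularValue_nonneg z n) (hs n) hp0.le
      _ = 12 ^ p * ∑ n ∈ Finset.range (k + 1), d (n / 4) ^ p := by rw [Finset.mul_sum]
      _ ≤ 12 ^ p * (4 * (M * ∑ n ∈ Finset.range (k + 1), ω n)) := by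
          gcongr
          refine (sum_div_le (g := fun n => d n ^ p) (fun n => Real.rpow_nonneg (h0 n) p)
            (m := 4) (by norm_num) (k + 1)).trans ?_
          have := hd (k + 1)
          push_cast
          gcongr
      _ = _ := by ring

variable {p : ℝ} (hp : 1 ≤ p) {ω : ℕ → ℝ} (hω : IsWeight ω)

/-- If all commutators `ax - xa` with `x ∈ C_{l_ω^p}` belong to `C_p`, then the entries `⟪f n, a (e n)⟫`
multiply `l_ω^p` into `l_p` for mutually orthogonal orthonormal sequences `e`, `f`. -/
theorem exists_sum_inner_rpow_le {a : H →L[ℂ] H}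
    (ha : ∀ x ∈ lorentzIdeal H hp hω, a * x - x * a ∈ schattenIdeal H hp) {e f : ℕ → H}
    (he : Orthonormal ℂ e) (hf : Orthonormal ℂ f) (hfe : ∀ m n, inner ℂ (f m) (e n) = 0)
    {d : ℕ → ℝ} (h0 : 0 ≤ d) (hd : ∀ n, d n ≤ 2 * ‖inner ℂ (f n) (a (e n))‖) :
    ∃ M, 0 ≤ M ∧ ∀ k, ∑ n ∈ Finset.range k, d n ^ p ≤ M * ∑ n ∈ Finset.range k, ω n := by
  have hp0 : 0 < p := zero_lt_one.trans_le hp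
  have h1p := one_div_nonneg.2 hp0.le
  refine exists_sum_le_of_forall_tsum_lt_top (fun n => Real.rpow_nonneg (h0 n) p) hω
    fun η hη hη0 hηs => ?_
  have hξ0 : ∀ n, 0 ≤ η n ^ (1 / p) := fun n => Real.rpow_nonneg (hη0 n) _
  have hξp : ∀ n, (η n ^ (1 / p)) ^ p = η n := fun n => by
    rw [← Real.rpow_mul (hη0 n), one_div_mul_cancel hp0.ne', Real.rpow_one]
  have hξlim : Tendsto (fun n => η n ^ (1 / p)) atTop (𝓝 0) := by
    have h4 := (tendsto_zero_of_antitone_of_tsum_lt_top hω hη hη0 hηs).rpow_const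
      (p := 1 / p) (Or.inr h1p)
    rwa [Real.zero_rpow (one_div_ne_zero hp0.ne')] at h4
  obtain ⟨x, hxe, hxf, hxc, hxs⟩ := exists_diagonal_operator he
    (ξ := fun n => η n ^ (1 / p)) (fun m n hmn => Real.rpow_le_rpow (hη0 n) (hη hmn) h1p)
    hξ0 hξlim
  have hx : x ∈ lorentzIdeal H hp hω := by
    refine ⟨hxc, squeeze_zero (singularValue_nonneg x) hxs hξlim, ?_⟩
    change opNorm (lorentzNorm p ω) x < ∞
    rw [opNorm_lorentzNorm]
    refine ENNReal.rpow_lt_top_of_nonneg h1p (ne_of_lt (lt_of_le_of_lt ?_ hηs))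
    refine ENNReal.tsum_le_tsum fun n => ENNReal.ofReal_le_ofReal ?_
    refine mul_le_mul_of_nonneg_right ?_ (hω.pos n).le
    rw [← hξp n]
    exact Real.rpow_le_rpow (singularValue_nonneg x n) (hxs n) hp0.le
  have hy := ha x hx
  have hfin : ∑' n, ENNReal.ofReal (singularValue (a * x - x * a) n ^ p) < ∞ := by
    have h1 : opNorm (lpNorm p) (a * x - x * a) < ∞ := hy.2.2
    rwa [opNorm_lpNorm, ENNReal.rpow_lt_top_iff_of_pos (one_div_pos.2 hp0)] at h1
  -- The term with `xa` vanishes because `f n` is orthogonal to the range of `x`.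
  have hentry : ∀ n, inner ℂ (f n) ((a * x - x * a) (e n)) =
      ((η n ^ (1 / p) : ℝ) : ℂ) * inner ℂ (f n) (a (e n)) := by
    intro n
    change inner ℂ (f n) (a (x (e n)) - x (a (e n))) = _
    rw [inner_sub_right, hxf _ _ (hfe n), sub_zero, hxe, map_smul, inner_smul_right]
  have hle : ∀ n, ENNReal.ofReal (d n ^ p * η n) ≤ ENNReal.ofReal (2 ^ p) *
      ENNReal.ofReal ‖inner ℂ (f n) ((a * x - x * a) (e n))‖ ^ p := by
    intro n
    rw [ENNReal.ofReal_rpow_of_nonneg (norm_nonneg _) hp0.le, ← ENNReal.ofReal_mul (by positivity)]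
    refine ENNReal.ofReal_le_ofReal ?_
    rw [hentry, norm_mul, Complex.norm_real, Real.norm_of_nonneg (hξ0 n),
      ← Real.mul_rpow (by norm_num) (mul_nonneg (hξ0 n) (norm_nonneg _))]
    conv_lhs => rw [← hξp n]
    rw [← Real.mul_rpow (h0 n) (hξ0 n)]
    refine Real.rpow_le_rpow (mul_nonneg (h0 n) (hξ0 n)) ?_ hp0.le
    have := mul_le_mul_of_nonneg_right (hd n) (hξ0 n)
    linarith
  refine (ENNReal.tsum_le_tsum hle).trans_lt ?_
  rw [ENNReal.tsum_mul_left]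
  exact ENNReal.mul_lt_top ENNReal.ofReal_lt_top
    ((tsum_inner_rpow_le hy.1 hp he hf).trans_lt hfin)

/-- The scalar cannot be avoided, as `a` and `a - l` have the same commutators. The decay of `ω`
enters here: it forces the greedy off-diagonal entries to 0. -/
theorem exists_scalar_sub_mem (hH : ¬ FiniteDimensional ℂ H) (hω0 : Tendsto ω atTop (𝓝 0))
    {a : H →L[ℂ] H} (ha : ∀ x ∈ lorentzIdeal H hp hω, a * x - x * a ∈ schattenIdeal H hp) :
    ∃ l : ℂ, a - l • 1 ∈ opClass H (seqSpace (marcinkiewiczNorm p ω)) := by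
  have hp0 : 0 < p := zero_lt_one.trans_le hp
  obtain ⟨G, e, f, hG, hrank, he, hf, hfe, heG, hd⟩ := exists_greedy_sequence hH a
  have hfin : ∀ n, FiniteDimensional ℂ (G n) := fun n =>
    Module.rank_lt_aleph0_iff.1 ((hrank n).trans_lt Cardinal.natCast_lt_aleph0)
  have hd0 : (0 : ℕ → ℝ) ≤ fun n => offDiag a (G n) := fun n => offDiag_nonneg a (G n)
  obtain ⟨M, -, hM⟩ := exists_sum_inner_rpow_le hp hω ha he hf hfe hd0 hd
  have hlim := tendsto_zero_of_sum_rpow_le hp0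
    (fun m n hmn => offDiag_anti hH a (hG hmn)) hd0 hω0 hM
  obtain ⟨l, hl⟩ := exists_sub_scalar_le a hG hrank he.1 heG hlim
  exact ⟨l, mem_marcinkiewicz_of_le hp hω hd0 hlim hM hl⟩

theorem rankOne_mem_lorentzIdeal (h g : H) :
    InnerProductSpace.rankOne ℂ h g ∈ lorentzIdeal H hp hω := by
  have hp0 : 0 < p := zero_lt_one.trans_le hp
  have hv : ∀ v ∈ (ℂ ∙ g)ᗮ, InnerProductSpace.rankOne ℂ h g v = 0 := by
    intro v hv
    rw [InnerProductSpace.rankOne_apply, hv _ (Submodule.mem_span_singleton_self g), zero_smul]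
  have hs : ∀ n, 1 ≤ n → singularValue (InnerProductSpace.rankOne ℂ h g) n = 0 := by
    intro n hn
    refine le_antisymm (le_of_forall_gt_imp_ge_of_dense fun r hr => ?_) (singularValue_nonneg _ n)
    refine singularValue_le _ n hr (ℂ ∙ g) ?_ fun v hv' => by
      rw [hv v hv', norm_zero]; positivity
    refine ((rank_span_le _).trans (Cardinal.mk_singleton g).le).trans ?_
    exact_mod_cast hn
  refine ⟨(isCompactOperator_of_forall_exists_le fun ε hε => ⟨ℂ ∙ g, inferInstance,
    fun v hv' => by rw [hv v hv', norm_zero]; positivity⟩).1,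
    tendsto_const_nhds.congr' ((eventually_ge_atTop 1).mono fun n hn => (hs n hn).symm), ?_⟩
  change opNorm (lorentzNorm p ω) _ < ∞
  rw [opNorm_lorentzNorm, tsum_eq_single 0 fun n hn => by
    rw [hs n (Nat.one_le_iff_ne_zero.2 hn), Real.zero_rpow hp0.ne', zero_mul, ENNReal.ofReal_zero]]
  exact ENNReal.rpow_lt_top_of_nonneg (one_div_nonneg.2 hp0.le) ENNReal.ofReal_ne_top

/-- A derivation on an ideal containing all operators of rank one is implemented by a bounded
operator. -/
theorem exists_eq_commutator_of_isDerivation [Nontrivial H] {I J : NonUnitalSubalgebra ℂ (H →L[ℂ] H)}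
    (hI : ∀ h g : H, InnerProductSpace.rankOne ℂ h g ∈ I) {δ : I →ₗ[ℂ] J} (hδ : IsDerivation δ) :
    ∃ a : H →L[ℂ] H, ∀ x, (δ x : H →L[ℂ] H) = a * x - x * a := by
  obtain ⟨e, he⟩ := exists_norm_eq H (zero_le_one' ℝ)
  have hee : inner ℂ e e = 1 := by rw [inner_self_eq_norm_sq_to_K, he]; simp
  let R : H →ₗ[ℂ] I :=
    { toFun := fun h => ⟨InnerProductSpace.rankOne ℂ h e, hI h e⟩
      map_add' := fun h k => Subtype.ext (by
        change InnerProductSpace.rankOne ℂ (h + k) e =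
          InnerProductSpace.rankOne ℂ h e + InnerProductSpace.rankOne ℂ k e
        simp)
      map_smul' := fun c h => Subtype.ext (by
        change InnerProductSpace.rankOne ℂ (c • h) e = c • InnerProductSpace.rankOne ℂ h e
        simp) }
  -- If `δ = δ_a`, then `δ(h ⊗ e) e` equals `a h` up to a scalar multiple of `h`. The derivation
  -- rule for `x (h ⊗ e) = (x h) ⊗ e`, evaluated at `e`, gives `b x = δ(x) + x b`.
  let b : H →ₗ[ℂ] H :=
    { toFun := fun h => (δ (R h) : H →L[ℂ] H) e
      map_add' := fun h k => by rw [map_add, map_add]; rfl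
      map_smul' := fun c h => by rw [map_smul, map_smul]; rfl }
  have hb : ∀ (x : I) (h : H), b ((x : H →L[ℂ] H) h) =
      (δ x : H →L[ℂ] H) h + (x : H →L[ℂ] H) (b h) := by
    intro x h
    have h1 : R ((x : H →L[ℂ] H) h) = x * R h := Subtype.ext (by
      change InnerProductSpace.rankOne ℂ ((x : H →L[ℂ] H) h) e =
        (x : H →L[ℂ] H) * InnerProductSpace.rankOne ℂ h e
      ext v
      simp)
    have h2 := congrArg (fun T : H →L[ℂ] H => T e) (hδ x (R h))
    rw [← h1] at h2
    change b ((x : H →L[ℂ] H) h) = (δ x : H →L[ℂ] H) (InnerProductSpace.rankOne ℂ h e e) +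
      (x : H →L[ℂ] H) (b h) at h2
    rwa [InnerProductSpace.rankOne_apply, hee, one_smul] at h2
  have hcont : Continuous b := by
    -- Applying `hb` to the operator `v ↦ ⟪g, v⟫ e` shows that `v ↦ ⟪g, b v⟫` is continuous for each
    -- `g`. Hence the graph of `b` is closed.
    refine b.continuous_of_seq_closed_graph fun s h k hs hbs => ?_
    refine ext_inner_left ℂ fun g => ?_
    let x : I := ⟨InnerProductSpace.rankOne ℂ e g, hI e g⟩
    have hx : ∀ v, (x : H →L[ℂ] H) v = inner ℂ g v • e := fun v => by
      simp [x]
    have hx' : ∀ v, inner ℂ g v • b e - (δ x : H →L[ℂ] H) v = inner ℂ g (b v) • e := by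
      intro v
      have h1 := hb x v
      rw [hx, hx, map_smul] at h1
      rw [h1, add_sub_cancel_left]
    have hc1 : Continuous fun v => inner ℂ g v • b e - (δ x : H →L[ℂ] H) v := by fun_prop
    have hc2 : Continuous fun v : H => inner ℂ g v • e := by fun_prop
    have t1 := (hc1.tendsto h).comp hs
    have t2 := (hc2.tendsto k).comp hbs
    have t3 := tendsto_nhds_unique (t2.congr fun n => (hx' (s n)).symm) t1
    rw [hx'] at t3
    have t4 := congrArg (fun w => inner ℂ e w) t3
    simpa only [inner_smul_right, hee, mul_one] using t4
  refine ⟨⟨b, hcont⟩, fun x => ?_⟩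
  ext h
  change (δ x : H →L[ℂ] H) h = b ((x : H →L[ℂ] H) h) - (x : H →L[ℂ] H) (b h)
  rw [hb, add_sub_cancel_right]

theorem exists_mem_marcinkiewicz_of_isDerivation (hH : ¬ FiniteDimensional ℂ H)
    (hω0 : Tendsto ω atTop (𝓝 0)) {δ : lorentzIdeal H hp hω →ₗ[ℂ] schattenIdeal H hp}
    (hδ : IsDerivation δ) :
    ∃ a ∈ opClass H (seqSpace (marcinkiewiczNorm p ω)),
      ∀ x, (δ x : H →L[ℂ] H) = a * x - x * a := by
  have : Nontrivial H := by
    by_contra h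
    rw [not_nontrivial_iff_subsingleton] at h
    exact hH inferInstance
  obtain ⟨a, ha⟩ := exists_eq_commutator_of_isDerivation (rankOne_mem_lorentzIdeal hp hω) hδ
  obtain ⟨l, hl⟩ := exists_scalar_sub_mem hp hω hH hω0 (a := a) fun x hx => by
    rw [← ha ⟨x, hx⟩]
    exact (δ ⟨x, hx⟩).2
  refine ⟨a - l • 1, hl, fun x => ?_⟩
  rw [ha, sub_mul, mul_sub, smul_mul_assoc, mul_smul_comm, one_mul, mul_one]
  abel

end Derivations

theorem corollary4p9 {H : Type*} [NormedAddCommGroup H] [InnerProductSpace ℂ H] [CompleteSpace H]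
    (hH : ¬ FiniteDimensional ℂ H) {p : ℝ} (hp : 1 ≤ p) {ω : ℕ → ℝ} (hω : IsWeight ω)
    (hω0 : Tendsto ω atTop (𝓝 0)) :
    (∀ δ : lorentzIdeal H hp hω →ₗ[ℂ] schattenIdeal H hp,
      IsDerivation δ ↔ ∃ a ∈ opClass H (seqSpace (marcinkiewiczNorm p ω)),
        ∀ x, (δ x : H →L[ℂ] H) = a * x - x * a) ∧
    ∀ a ∈ opClass H (seqSpace (marcinkiewiczNorm p ω)),
      a ∈ dualSpace (schattenIdeal H hp) (lorentzIdeal H hp hω) ∧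
      (∃ δ : lorentzIdeal H hp hω →ₗ[ℂ] schattenIdeal H hp,
        ∀ x, (δ x : H →L[ℂ] H) = a * x - x * a) ∧
      ∀ δ : lorentzIdeal H hp hω →ₗ[ℂ] schattenIdeal H hp,
        (∀ x, (δ x : H →L[ℂ] H) = a * x - x * a) →
        mapNorm (lpNorm p) (lorentzNorm p ω) δ
            ≤ 2 * dualNorm (lpNorm p) (lorentzNorm p ω) (lorentzIdeal H hp hω) a ∧
          2 * dualNorm (lpNorm p) (lorentzNorm p ω) (lorentzIdeal H hp hω) a
            ≤ 4 * opNorm (marcinkiewiczNorm p ω) a := by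
  refine ⟨fun δ => ⟨fun hδ => exists_mem_marcinkiewicz_of_isDerivation hp hω hH hω0 hδ,
    fun ⟨a, _, ha⟩ => isDerivation_of_eq_commutator ha⟩, fun a ha =>
    ⟨fun x hx => mul_mem_schattenIdeal hp hω ha hx, exists_inner_linearMap hp hω ha,
      fun δ hδ => ⟨mapNorm_le_dualNorm hp hω ha hδ, ?_⟩⟩⟩
  refine (mul_le_mul_right (dualNorm_le hp hω ha) 2).trans_eq ?_
  rw [← mul_assoc]
  norm_num
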